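/- For a polynomial $P$ with integer coefficients let $H(P)$ be the maximum of the absolute values of its coefficients. The minimal polynomial over $\mathbb Z$ of an algebraic number $\alpha\in\mathbb C$ is the irreducible, primitive polynomial in $\mathbb Z[X]$ with positive leading coefficient that vanishes at $\alpha$; the degree of $\alpha$ and its height $H(\alpha)$ are the degree and the height of this polynomial. For a real number $\xi$ and an integer $n\ge 1$, let $w_n(\xi)$ be the supremum in $[-\infty,+\infty]$ of the real numbers $w$ such that $$0<|P(\xi)|\le H(P)^{-w}$$ for infinitely many $P\in\mathbb Z[X]$ of degree at most $n$, and let $w_n^*(\xi)$ be the supremum in $[-\infty,+\infty]$ of the real numbers $w^*$ such that $$0<|\xi-\alpha|\le H(\alpha)^{-w^*-1}$$ for infinitely many algebraic numbers $\alpha\in\mathbb C$ of degree at most $n$. Theorem. Let $d\ge 2$ be an integer and let $w\ge \bigl(3d+2+\sqrt{9d^2+4d+4}\bigr)/2$ be a real number. Let $a,b$ be distinct positive integers. Let $(a_{k,w})_{k\ge 1}$ be the sequence given by $a_{k,w}=b$ if $k=\lfloor w^i\rfloor$ for some integer $i\ge 0$, and $a_{k,w}=a$ otherwise. Then the continued fraction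 $$\xi_w:=[0,a_{1,w},a_{2,w},\ldots]=\cfrac{1}{a_{1,w}+\cfrac{1}{a_{2,w}+\cdots}}$$ converges to a real number, and $$w_n^*(\xi_w)=w-1,\qquad w_n(\xi_w)=w$$ for all $2\le n\le d$. -/

import Mathlib

open Filter Topology Polynomial

noncomputable section

/-- The exponent `w_n(ξ)`: the supremum, in `[-∞, +∞]`, of the real numbers `w` such that
`0 < |P(ξ)| ≤ H(P)^(-w)` for infinitely many integer polynomials `P` of degree at most `n`.
The height `H(P)`, the maximum of the absolute values of the coefficients, is `P.supNorm`. -/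
def mahlerExponent (n : ℕ) (ξ : ℝ) : EReal :=
  sSup ((fun w : ℝ => (w : EReal)) ''
    {w : ℝ | {P : ℤ[X] | P.natDegree ≤ n ∧ 0 < |aeval ξ P| ∧
      |aeval ξ P| ≤ P.supNorm ^ (-w)}.Infinite})

/-- `P` is the minimal polynomial over `ℤ` of the complex number `α`: the irreducible, primitive
integer polynomial with positive leading coefficient that vanishes at `α`. -/
def IsIntMinpoly (P : ℤ[X]) (α : ℂ) : Prop :=
  Irreducible P ∧ P.IsPrimitive ∧ 0 < P.leadingCoeff ∧ aeval α P = 0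

/-- The exponent `w_n^*(ξ)`: the supremum, in `[-∞, +∞]`, of the real numbers `w` such that
`0 < |ξ - α| ≤ H(α)^(-w-1)` for infinitely many algebraic numbers `α` of degree at most `n`.
The degree and the height of `α` are those of its minimal polynomial over `ℤ`. -/
def koksmaExponent (n : ℕ) (ξ : ℝ) : EReal :=
  sSup ((fun w : ℝ => (w : EReal)) ''
    {w : ℝ | {α : ℂ | ∃ P : ℤ[X], IsIntMinpoly P α ∧ P.natDegree ≤ n ∧
      0 < ‖(ξ : ℂ) - α‖ ∧ ‖(ξ : ℂ) - α‖ ≤ P.supNorm ^ (-w - 1)}.Infinite})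

/-- The infinite simple continued fraction `[0, c 1, c 2, c 3, …]`. -/
def contFracOfSeq (c : ℕ → ℕ) : GenContFract ℝ where
  h := 0
  s := Stream'.Seq.ofStream (fun k => ⟨1, (c (k + 1) : ℝ)⟩)

/-- The real number `ξ` is the value of `[0, c 1, c 2, c 3, …]`: its convergents tend to `ξ`. -/
def IsContFracValue (c : ℕ → ℕ) (ξ : ℝ) : Prop :=
  Tendsto (fun k : ℕ => (contFracOfSeq c).convs k) atTop (𝓝 ξ)

open Classical in
/-- The sequence whose `k`-th term is `b` if `k = ⌊w ^ i⌋` for some integer `i ≥ 0`, and `a`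
otherwise. -/
def sparseSeq (w : ℝ) (a b : ℕ) (k : ℕ) : ℕ :=
  if ∃ i : ℕ, k = ⌊w ^ i⌋₊ then b else a

end

/-! Let `k i = ⌊w ^ i⌋`. Replacing every partial quotient of `ξ` after place `k i` by `a` gives a
quadratic number `α`, with minimal polynomial `R i` up to sign (`cfQuad`). All `R i` have the same
discriminant `a ^ 2 + 4`. Their heights are comparable with `h i`, the squared denominator of the
convergent at place `k i`. The expansions of `α` and `ξ` first differ at `k (i + 1)`, so `|R i (ξ)|`
is comparable with `1 / h (i + 1)`, and `h (i + 1) = h i ^ (w + o(1))` because `log (h i)` is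
asymptotic to a multiple of `w ^ i`. The two roots are at distance `√D / A`, with `A` the leading
coefficient, so `|ξ - α|` is of the order of `|R i (ξ)|` itself. This gives `w_n ≥ w` and `w_n^* ≥ w
- 1`. The structure `IsQuadApprox` records these properties (`exists_isQuadApprox`).

For the upper bounds, let `P` have degree at most `n`, height `H`, and no divisor among the `R i`.
The nonzero integer `Res(R i, P)` gives `1 ≪ h i ^ n * H * (|P(ξ)| + H / h (i + 1))`
(`exists_one_le_mul`). Taking the first `i` for which the second summand is harmless yields `|P(ξ)|
≫ H ^ (-s)` for every `s > 1 + 2 n w / (w - n)` (`exists_le_of_forall_not_dvd`). The lower bound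
assumed on `w` says exactly, for `n = d`, that this threshold is at most `w - 1`. Polynomials
divisible by some `R i` are treated by Gelfond's inequality and induction on the degree
(`exists_le`). For `w_n^*`, a minimal polynomial is either some `R i` or divisible by none
(`exists_le_norm_sub`). -/

/-! ### Values and heights of integer polynomials. -/

lemma norm_pow_sub_pow_le_mul {K : Type*} [NormedField K] {x y : K} {M : ℝ} (hM : 1 ≤ M)
    (hx : ‖x‖ ≤ M) (hy : ‖y‖ ≤ M) (j : ℕ) : ‖x ^ j - y ^ j‖ ≤ j * M ^ j * ‖x - y‖ := by
  induction j with
  | zero => simp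
  | succ j ih =>
    have h1 : x ^ (j + 1) - y ^ (j + 1) = x * (x ^ j - y ^ j) + (x - y) * y ^ j := by ring
    have h2 : ‖y‖ ^ j ≤ M ^ j := pow_le_pow_left₀ (norm_nonneg _) hy j
    have h3 : M ^ j ≤ M ^ (j + 1) := pow_le_pow_right₀ hM (Nat.le_succ j)
    calc ‖x ^ (j + 1) - y ^ (j + 1)‖ ≤ ‖x‖ * ‖x ^ j - y ^ j‖ + ‖x - y‖ * ‖y‖ ^ j := by
          rw [h1]; exact (norm_add_le _ _).trans (by rw [norm_mul, norm_mul, norm_pow])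
      _ ≤ M * (j * M ^ j * ‖x - y‖) + ‖x - y‖ * M ^ (j + 1) := by
          gcongr
          exact h2.trans h3
      _ = _ := by push_cast; ring

lemma aeval_eq_sum_range_of_natDegree_le {K : Type*} [CommRing K] {P : ℤ[X]} {n : ℕ}
    (hP : P.natDegree ≤ n) (x : K) :
    aeval x P = ∑ j ∈ Finset.range (n + 1), (P.coeff j : K) * x ^ j := by
  rw [aeval_eq_sum_range' (Nat.lt_succ_of_le hP)]
  simp

lemma norm_intCast_coeff_le {K : Type*} [RCLike K] (P : ℤ[X]) (j : ℕ) :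
    ‖(P.coeff j : K)‖ ≤ P.supNorm := by
  refine le_trans (le_of_eq ?_) (P.le_supNorm j)
  have h : ((P.coeff j : ℤ) : K) = (((P.coeff j : ℤ) : ℝ) : K) := by simp
  rw [h, RCLike.norm_ofReal, Int.norm_eq_abs]

lemma norm_aeval_le {K : Type*} [RCLike K] {P : ℤ[X]} {n : ℕ} (hP : P.natDegree ≤ n) {x : K}
    {M : ℝ} (hM : 1 ≤ M) (hx : ‖x‖ ≤ M) : ‖aeval x P‖ ≤ (n + 1) * M ^ n * P.supNorm := by
  rw [aeval_eq_sum_range_of_natDegree_le hP]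
  have h : ∀ j ∈ Finset.range (n + 1), ‖(P.coeff j : K) * x ^ j‖ ≤ P.supNorm * M ^ n := by
    intro j hj
    rw [norm_mul, norm_pow]
    have h1 : ‖x‖ ^ j ≤ M ^ j := pow_le_pow_left₀ (norm_nonneg _) hx j
    have h2 : M ^ j ≤ M ^ n :=
      pow_le_pow_right₀ hM (Nat.lt_succ_iff.1 (Finset.mem_range.1 hj))
    have := norm_intCast_coeff_le (K := K) P j
    have := P.supNorm_nonneg
    gcongr
    exact h1.trans h2
  refine (norm_sum_le_of_le _ h).trans (le_of_eq ?_)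
  simp
  ring

lemma norm_aeval_sub_aeval_le {K : Type*} [RCLike K] {P : ℤ[X]} {n : ℕ} (hP : P.natDegree ≤ n)
    {x y : K} {M : ℝ} (hM : 1 ≤ M) (hx : ‖x‖ ≤ M) (hy : ‖y‖ ≤ M) :
    ‖aeval x P - aeval y P‖ ≤ (n + 1) * (n * M ^ n) * P.supNorm * ‖x - y‖ := by
  rw [aeval_eq_sum_range_of_natDegree_le hP, aeval_eq_sum_range_of_natDegree_le hP,
    ← Finset.sum_sub_distrib]
  have h : ∀ j ∈ Finset.range (n + 1), ‖(P.coeff j : K) * x ^ j - (P.coeff j : K) * y ^ j‖ ≤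
      P.supNorm * (n * M ^ n * ‖x - y‖) := by
    intro j hj
    have hjn : j ≤ n := Nat.lt_succ_iff.1 (Finset.mem_range.1 hj)
    rw [← mul_sub, norm_mul]
    have h1 := norm_pow_sub_pow_le_mul hM hx hy j
    have h2 : M ^ j ≤ M ^ n := pow_le_pow_right₀ hM hjn
    have h3 : (j : ℝ) ≤ n := by exact_mod_cast hjn
    have := norm_intCast_coeff_le (K := K) P j
    have := P.supNorm_nonneg
    gcongr
    refine h1.trans ?_
    gcongr
  refine (norm_sum_le_of_le _ h).trans (le_of_eq ?_)
  simp
  ring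

lemma one_le_supNorm {P : ℤ[X]} (hP : P ≠ 0) : 1 ≤ P.supNorm := by
  refine le_trans ?_ (P.le_supNorm P.natDegree)
  rw [Int.norm_eq_abs]
  exact_mod_cast Int.one_le_abs (leadingCoeff_ne_zero.2 hP)

lemma supNorm_map_castRingHom (P : ℤ[X]) : (P.map (Int.castRingHom ℂ)).supNorm = P.supNorm := by
  rw [supNorm_eq_iSup, supNorm_eq_iSup]
  simp [Int.norm_eq_abs]

/-- Gelfond's inequality: the Mahler measure is multiplicative and comparable with the height up to
factors depending only on the degree. -/
lemma supNorm_mul_supNorm_le {n : ℕ} {P Q : ℤ[X]} (hP : P ≠ 0) (hQ : Q ≠ 0)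
    (h : (P * Q).natDegree ≤ n) :
    P.supNorm * Q.supNorm ≤ 2 ^ n * √(n + 1) * (P * Q).supNorm := by
  have key : ∀ S : ℤ[X], S.supNorm ≤
      2 ^ S.natDegree * (S.map (Int.castRingHom ℂ)).mahlerMeasure := by
    intro S
    have h1 := supNorm_le_choose_natDegree_div_two_mul_mahlerMeasure (S.map (Int.castRingHom ℂ))
    rw [supNorm_map_castRingHom, natDegree_map_eq_of_injective (Int.castRingHom ℂ).injective_int]
      at h1
    refine h1.trans ?_
    have := mahlerMeasure_nonneg (S.map (Int.castRingHom ℂ))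
    gcongr
    exact_mod_cast Nat.choose_le_two_pow _ _
  have h2 := mahlerMeasure_le_sqrt_natDegree_add_one_mul_supNorm ((P * Q).map (Int.castRingHom ℂ))
  rw [supNorm_map_castRingHom, natDegree_map_eq_of_injective (Int.castRingHom ℂ).injective_int,
    Polynomial.map_mul, mahlerMeasure_mul] at h2
  have hd : (P * Q).natDegree = P.natDegree + Q.natDegree := natDegree_mul hP hQ
  have hp := mahlerMeasure_nonneg (P.map (Int.castRingHom ℂ))
  have hq := mahlerMeasure_nonneg (Q.map (Int.castRingHom ℂ))
  have h3 : (2 : ℝ) ^ P.natDegree * 2 ^ Q.natDegree ≤ 2 ^ n := by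
    rw [← pow_add, ← hd]; exact pow_le_pow_right₀ one_le_two h
  have h4 : √(((P * Q).natDegree : ℝ) + 1) ≤ √(n + 1) :=
    Real.sqrt_le_sqrt (by have : ((P * Q).natDegree : ℝ) ≤ n := by exact_mod_cast h
                          linarith)
  have := (P * Q).supNorm_nonneg
  calc P.supNorm * Q.supNorm
      ≤ (2 ^ P.natDegree * (P.map (Int.castRingHom ℂ)).mahlerMeasure) *
        (2 ^ Q.natDegree * (Q.map (Int.castRingHom ℂ)).mahlerMeasure) :=
        mul_le_mul (key P) (key Q) Q.supNorm_nonneg (by positivity)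
    _ = (2 ^ P.natDegree * 2 ^ Q.natDegree) * ((P.map (Int.castRingHom ℂ)).mahlerMeasure *
        (Q.map (Int.castRingHom ℂ)).mahlerMeasure) := by ring
    _ ≤ 2 ^ n * (√(n + 1) * (P * Q).supNorm) := by
        refine mul_le_mul h3 (h2.trans ?_) (by positivity) (by positivity)
        gcongr
    _ = _ := by ring

lemma finite_setOf_natDegree_le_supNorm_le (n : ℕ) (B : ℝ) :
    {P : ℤ[X] | P.natDegree ≤ n ∧ P.supNorm ≤ B}.Finite := by
  refine (finite_mahlerMeasure_le n (√(n + 1) * B).toNNReal).subset ?_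
  rintro P ⟨hn, hB⟩
  refine ⟨hn, le_trans ?_ (Real.le_coe_toNNReal _)⟩
  have h2 := mahlerMeasure_le_sqrt_natDegree_add_one_mul_supNorm (P.map (Int.castRingHom ℂ))
  rw [supNorm_map_castRingHom, natDegree_map_eq_of_injective (Int.castRingHom ℂ).injective_int]
    at h2
  refine h2.trans ?_
  have : (P.natDegree : ℝ) ≤ n := by exact_mod_cast hn
  have := P.supNorm_nonneg
  gcongr

/-! ### Resultants with quadratics, suprema of exponents, roots of quadratics. -/

/-- If `P` is an integer polynomial not divisible by a primitive irreducible quadratic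
`R = A (X - α) (X - β)`, then the integer `Res(R, P) = A ^ n P(α) P(β)` does not vanish. -/
lemma one_le_abs_leadingCoeff_pow_mul_aeval_mul_aeval {R P : ℤ[X]} {n : ℕ} {α β : ℝ}
    (hR : Irreducible R) (hdeg : R.natDegree = 2) (hP : P.natDegree ≤ n)
    (hfac : R.map (Int.castRingHom ℝ) = C (R.leadingCoeff : ℝ) * ((X - C α) * (X - C β)))
    (hdvd : ¬ R ∣ P) :
    1 ≤ |(R.leadingCoeff : ℝ) ^ n * (aeval α P * aeval β P)| := by
  have hR0 : R ≠ 0 := hR.ne_zero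
  have hA : (R.leadingCoeff : ℝ) ≠ 0 := by exact_mod_cast leadingCoeff_ne_zero.2 hR0
  have hinj := (Int.castRingHom ℝ).injective_int
  have hne : ((X - C α) * (X - C β) : ℝ[X]) ≠ 0 := mul_ne_zero (X_sub_C_ne_zero _) (X_sub_C_ne_zero _)
  have hroots : (R.map (Int.castRingHom ℝ)).roots = {α, β} := by
    rw [hfac, roots_C_mul _ hA, roots_mul hne, roots_X_sub_C, roots_X_sub_C]
    rfl
  have hsplit : (R.map (Int.castRingHom ℝ)).Splits := by
    rw [hfac]
    exact (Splits.C _).mul ((Splits.X_sub_C _).mul (Splits.X_sub_C _))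
  have hres : ((resultant R P 2 n : ℤ) : ℝ) =
      (R.leadingCoeff : ℝ) ^ n * (aeval α P * aeval β P) := by
    have h1 := resultant_eq_prod_eval (R.map (Int.castRingHom ℝ)) (P.map (Int.castRingHom ℝ)) n
      (natDegree_map_le.trans hP) hsplit
    rw [natDegree_map_eq_of_injective hinj, hdeg, resultant_map_map, hroots,
      leadingCoeff_map_of_injective hinj] at h1
    simpa [eval_map, aeval_def] using h1
  -- By Gauss's lemma `R` is irreducible over `ℚ`, hence coprime to `P`; a Bézout relation then
  -- excludes a common root.
  have hroot : ∀ γ : ℝ, aeval γ R = 0 → aeval γ P ≠ 0 := by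
    intro γ h1 h2
    have hcop : ¬ IsCoprime (R.map (Int.castRingHom ℚ)) (P.map (Int.castRingHom ℚ)) := by
      rintro ⟨u, v, huv⟩
      have := congrArg (aeval γ) huv
      have e : ∀ S : ℤ[X], aeval γ (S.map (Int.castRingHom ℚ)) = aeval γ S := by
        intro S
        exact aeval_map_algebraMap ℚ γ S
      simp [e, h1, h2] at this
    have hprim : R.IsPrimitive := hR.isPrimitive (by omega)
    have hirr := (IsPrimitive.Int.irreducible_iff_irreducible_map_cast hprim).1 hR
    have hdvd' := (hirr.isCoprime_or_dvd _).resolve_left hcop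
    exact hdvd ((IsPrimitive.Int.dvd_iff_map_cast_dvd_map_cast _ _ hprim).2 hdvd')
  have hroot' : ∀ γ, (γ = α ∨ γ = β) → aeval γ R = 0 := by
    intro γ hγ
    have : aeval γ R = (R.map (Int.castRingHom ℝ)).eval γ := by rw [eval_map, aeval_def]; rfl
    rw [this, hfac]
    rcases hγ with rfl | rfl <;> simp
  rw [← hres]
  have hne : resultant R P 2 n ≠ 0 := by
    intro h0
    rw [h0, Int.cast_zero] at hres
    exact mul_ne_zero (pow_ne_zero _ hA) (mul_ne_zero (hroot α (hroot' α (.inl rfl)))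
      (hroot β (hroot' β (.inr rfl)))) hres.symm
  exact_mod_cast Int.one_le_abs hne

lemma exists_pos_forall_le_of_eventually_le {f : ℕ → ℝ} (hf : ∀ i, 0 < f i) {c : ℝ} (hc : 0 < c)
    (h : ∀ᶠ i in atTop, c ≤ f i) : ∃ c' > 0, ∀ i, c' ≤ f i := by
  obtain ⟨N, hN⟩ := eventually_atTop.1 h
  obtain ⟨j, -, hj⟩ := Finset.exists_min_image (Finset.range (N + 1)) f ⟨0, by simp⟩
  refine ⟨min c (f j), lt_min hc (hf j), fun i => ?_⟩
  rcases le_total N i with hi | hi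
  · exact (min_le_left _ _).trans (hN i hi)
  · exact (min_le_right _ _).trans (hj i (Finset.mem_range.2 (by omega)))

/-- Positive values tending to `0` cannot come from a finite set, since its image under `F` would be
closed. -/
lemma infinite_of_eventually_mem_of_tendsto_zero {X : Type*} {S : Set X} {u : ℕ → X} {F : X → ℝ}
    (hpos : ∀ i, 0 < F (u i)) (hlim : Tendsto (fun i => F (u i)) atTop (𝓝 0))
    (hmem : ∀ᶠ i in atTop, u i ∈ S) : S.Infinite := by
  intro hfin
  have hc : IsClosed (F '' (S ∩ {x | 0 < F x})) :=
    ((hfin.subset Set.inter_subset_left).image F).isClosed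
  obtain ⟨x, ⟨-, hx⟩, h0⟩ := hc.mem_of_tendsto hlim
    (hmem.mono fun i hi => ⟨u i, ⟨hi, hpos i⟩, rfl⟩)
  exact hx.ne' h0

lemma le_sSup_image_coe_of_forall_mem {S : Set ℝ} {l w : ℝ} (hl : l < w)
    (h : ∀ x, l < x → x < w → x ∈ S) : (w : EReal) ≤ sSup ((fun x : ℝ => (x : EReal)) '' S) := by
  refine le_of_forall_lt fun y hy => ?_
  obtain ⟨z, hz1, hz2⟩ := EReal.lt_iff_exists_real_btwn.1
    (max_lt hy (EReal.coe_lt_coe_iff.2 hl))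
  exact ((le_max_left _ _).trans_lt hz1).trans_le (le_sSup ⟨z, h z
    (EReal.coe_lt_coe_iff.1 ((le_max_right _ _).trans_lt hz1)) (EReal.coe_lt_coe_iff.1 hz2), rfl⟩)

/-- For `α` the root nearer to `ξ` and `β` the other one, `A * |ξ - β| ≥ √D / 2 ≥ 1`, so `|ξ - α|`
is at most `|R(ξ)|`. The roots differ by `√D / A`. -/
lemma exists_real_roots_of_discrim {R : ℤ[X]} {D : ℤ} (hdeg : R.natDegree = 2)
    (hlead : 0 < R.leadingCoeff) (hD : 4 ≤ D)
    (hdisc : R.coeff 1 ^ 2 - 4 * R.coeff 2 * R.coeff 0 = D) (ξ : ℝ) :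
    ∃ α β : ℝ, R.map (Int.castRingHom ℝ) = C (R.leadingCoeff : ℝ) * ((X - C α) * (X - C β)) ∧
      |ξ - α| ≤ |aeval ξ R| ∧ |α - β| ≤ √D := by
  have hlc : R.leadingCoeff = R.coeff 2 := by rw [leadingCoeff, hdeg]
  rw [hlc] at hlead ⊢
  have hev : aeval ξ R = R.coeff 2 * ξ ^ 2 + R.coeff 1 * ξ + R.coeff 0 := by
    rw [aeval_eq_sum_range_of_natDegree_le hdeg.le, Finset.sum_range_succ, Finset.sum_range_succ,
      Finset.sum_range_one]
    ring
  have hmap : R.map (Int.castRingHom ℝ) =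
      C (R.coeff 2 : ℝ) * X ^ 2 + C (R.coeff 1 : ℝ) * X + C (R.coeff 0 : ℝ) := by
    conv_lhs => rw [eq_quadratic_of_degree_le_two (natDegree_le_iff_degree_le.1 hdeg.le)]
    simp
  rw [hev, hmap]
  have hA : (1 : ℝ) ≤ (R.coeff 2 : ℤ) := by exact_mod_cast hlead
  have hdisc' : (R.coeff 1 : ℝ) ^ 2 - 4 * R.coeff 2 * R.coeff 0 = D := by exact_mod_cast hdisc
  set A : ℝ := ((R.coeff 2 : ℤ) : ℝ)
  set B : ℝ := ((R.coeff 1 : ℤ) : ℝ)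
  set E : ℝ := ((R.coeff 0 : ℤ) : ℝ)
  have hD' : (4 : ℝ) ≤ D := by exact_mod_cast hD
  obtain ⟨s, hs2, hs⟩ : ∃ s : ℝ, 2 ≤ s ∧ s ^ 2 = D :=
    ⟨√D, Real.le_sqrt_of_sq_le (by linarith), Real.sq_sqrt (by linarith)⟩
  have hsq : √(D : ℝ) = s := by rw [← hs, Real.sqrt_sq (by linarith)]
  rw [hsq]
  have hfac : ∀ σ : ℝ, σ ^ 2 = D → C A * X ^ 2 + C B * X + C E =
      C A * ((X - C ((-B + σ) / (2 * A))) * (X - C ((-B - σ) / (2 * A)))) := by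
    intro σ hσ
    have e1 : B = -(A * ((-B + σ) / (2 * A) + (-B - σ) / (2 * A))) := by field_simp; ring
    have e2 : E = A * ((-B + σ) / (2 * A) * ((-B - σ) / (2 * A))) := by
      field_simp; linear_combination hσ - hdisc'
    set u := (-B + σ) / (2 * A)
    set t := (-B - σ) / (2 * A)
    conv_lhs => rw [e1, e2]
    simp only [C_neg, C_mul, C_add]
    ring
  have hdist : ∀ σ : ℝ, σ ^ 2 = D → |σ| = s →
      |(-B + σ) / (2 * A) - (-B - σ) / (2 * A)| ≤ s := by
    intro σ _ h
    have : (-B + σ) / (2 * A) - (-B - σ) / (2 * A) = σ / A := by field_simp; ring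
    rw [this, abs_div, h, abs_of_pos (by linarith)]
    exact div_le_self (by linarith) hA
  have hclose : ∀ σ : ℝ, σ ^ 2 = D → s ≤ |2 * A * ξ + B + σ| →
      |ξ - (-B + σ) / (2 * A)| ≤ |A * ξ ^ 2 + B * ξ + E| := by
    intro σ hσ h
    have e1 : A * ξ ^ 2 + B * ξ + E =
        (ξ - (-B + σ) / (2 * A)) * ((2 * A * ξ + B + σ) / 2) := by
      have : E = (B ^ 2 - σ ^ 2) / (4 * A) := by
        rw [eq_div_iff (by positivity)]; linarith
      rw [this]; field_simp; ring
    rw [e1, abs_mul]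
    refine le_mul_of_one_le_right (abs_nonneg _) ?_
    rw [abs_div, abs_two]
    linarith
  -- The sign of `2 * A * ξ + B` tells on which side of the midpoint of the roots `ξ` lies, hence
  -- which root is nearer.
  rcases le_total 0 (2 * A * ξ + B) with h | h
  · refine ⟨_, _, hfac s hs, hclose s hs ?_, hdist s hs (abs_of_pos (by linarith))⟩
    exact le_trans (by linarith) (le_abs_self _)
  · have hs' : (-s) ^ 2 = (D : ℝ) := by rw [neg_sq, hs]
    refine ⟨_, _, hfac (-s) hs', hclose (-s) hs' ?_, hdist (-s) hs' ?_⟩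
    · exact le_trans (by linarith) (neg_le_abs _)
    · rw [abs_neg, abs_of_pos (by linarith)]

/-! ### Exponents of a number with good quadratic approximations. -/

/-- The irreducible integer quadratics `R i`, all of discriminant `D`, have heights comparable
with `h i` and values at `ξ` comparable with `1 / h (i + 1)`, where `h (i + 1) = h i ^ (w + o(1))`. -/
structure IsQuadApprox (ξ w : ℝ) (D : ℤ) (K : ℝ) (R : ℕ → ℤ[X]) (h : ℕ → ℝ) : Prop where
  nonneg : 0 ≤ ξ
  le_one : ξ ≤ 1
  four_le : 4 ≤ D
  one_le_K : 1 ≤ K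
  natDegree_eq : ∀ i, (R i).natDegree = 2
  irreducible : ∀ i, Irreducible (R i)
  lead_pos : ∀ i, 0 < (R i).leadingCoeff
  disc : ∀ i, (R i).coeff 1 ^ 2 - 4 * (R i).coeff 2 * (R i).coeff 0 = D
  one_le_h : ∀ i, 1 ≤ h i
  supNorm_le : ∀ i, (R i).supNorm ≤ K * h i
  le_lead : ∀ i, h i ≤ K * (R i).leadingCoeff
  val_le : ∀ i, |aeval ξ (R i)| * h (i + 1) ≤ K
  le_val : ∀ i, 1 ≤ K * |aeval ξ (R i)| * h (i + 1)
  tendsto_h : Tendsto h atTop atTop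
  le_growth : ∀ v < w, ∀ᶠ i in atTop, h i ^ v ≤ h (i + 1)
  growth_le : ∀ v > w, ∀ᶠ i in atTop, h (i + 1) ≤ h i ^ v

namespace IsQuadApprox

variable {ξ w : ℝ} {D : ℤ} {K : ℝ} {R : ℕ → ℤ[X]} {h : ℕ → ℝ}

lemma abs_xi_le (H : IsQuadApprox ξ w D K R h) : |ξ| ≤ 1 :=
  abs_le.2 ⟨by linarith [H.nonneg], H.le_one⟩

lemma leadingCoeff_le_supNorm (P : ℤ[X]) : (P.leadingCoeff : ℝ) ≤ P.supNorm := by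
  refine le_trans ?_ (P.le_supNorm P.natDegree)
  rw [Int.norm_eq_abs]
  exact le_abs_self _

lemma abs_aeval_pos (H : IsQuadApprox ξ w D K R h) (i : ℕ) : 0 < |aeval ξ (R i)| := by
  rcases (abs_nonneg (aeval ξ (R i))).eq_or_lt with h0 | h0
  · have := H.le_val i
    rw [← h0] at this
    norm_num at this
  · exact h0

lemma abs_aeval_le (H : IsQuadApprox ξ w D K R h) (i : ℕ) :
    |aeval ξ (R i)| ≤ K / h (i + 1) := by
  rw [le_div_iff₀ (by linarith [H.one_le_h (i + 1)])]
  exact H.val_le i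

lemma tendsto_abs_aeval (H : IsQuadApprox ξ w D K R h) :
    Tendsto (fun i => |aeval ξ (R i)|) atTop (𝓝 0) :=
  squeeze_zero (fun _ => abs_nonneg _) H.abs_aeval_le
    (Tendsto.const_div_atTop (H.tendsto_h.comp (tendsto_add_atTop_nat 1)) K)

/-- In `1 ≤ |A ^ n * P(α) * P(β)|`, the factor `P(β)` is `O(H(P))` because `β` stays bounded, and
`P(α)` is compared with `P(ξ)` through `|ξ - α| ≤ K / h (i + 1)`. -/
lemma exists_one_le_mul (H : IsQuadApprox ξ w D K R h) (n : ℕ) :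
    ∃ K' ≥ 1, ∀ P : ℤ[X], P.natDegree ≤ n → ∀ i, ¬ R i ∣ P →
      1 ≤ K' * h i ^ n * P.supNorm * (|aeval ξ P| + K' * P.supNorm / h (i + 1)) := by
  have hK := H.one_le_K
  set M : ℝ := 1 + K + √D with hMdef
  have hs := Real.sqrt_nonneg (D : ℝ)
  have hM : 1 ≤ M := by linarith
  have hM0 : 0 ≤ M := by linarith
  set K₁ : ℝ := K ^ n * ((n + 1) * M ^ n) with hK1
  set K₂ : ℝ := (n + 1) * (n * M ^ n) * K with hK2
  have hK10 : 0 ≤ K₁ := by positivity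
  have hK20 : 0 ≤ K₂ := by positivity
  refine ⟨1 + K₁ + K₂, by linarith, fun P hP i hdvd => ?_⟩
  obtain ⟨α, β, hfac, hα, hβ⟩ := exists_real_roots_of_discrim (H.natDegree_eq i) (H.lead_pos i)
    H.four_le (H.disc i) ξ
  have hres := one_le_abs_leadingCoeff_pow_mul_aeval_mul_aeval (H.irreducible i)
    (H.natDegree_eq i) hP hfac hdvd
  have hh := H.one_le_h (i + 1)
  have hhi := H.one_le_h i
  have hξα : |ξ - α| ≤ K / h (i + 1) := hα.trans (H.abs_aeval_le i)
  have hξα' : |ξ - α| ≤ K := hξα.trans (div_le_self (by linarith) hh)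
  have hξ := H.abs_xi_le
  have hαM : |α| ≤ 1 + K := by
    calc |α| = |ξ - (ξ - α)| := by ring_nf
      _ ≤ |ξ| + |ξ - α| := abs_sub _ _
      _ ≤ _ := by linarith
  have hβM : |β| ≤ M := by
    calc |β| = |α - (α - β)| := by ring_nf
      _ ≤ |α| + |α - β| := abs_sub _ _
      _ ≤ _ := by linarith
  have hPβ : |aeval β P| ≤ (n + 1) * M ^ n * P.supNorm :=
    norm_aeval_le (x := β) hP hM hβM
  have hPd : |aeval ξ P - aeval α P| ≤ (n + 1) * (n * M ^ n) * P.supNorm * |ξ - α| :=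
    norm_aeval_sub_aeval_le hP hM (x := ξ) (y := α) (by rw [Real.norm_eq_abs]; linarith)
      (by rw [Real.norm_eq_abs]; linarith)
  have hH := P.supNorm_nonneg
  have hPα : |aeval α P| ≤ |aeval ξ P| + K₂ * P.supNorm / h (i + 1) := by
    calc |aeval α P| = |aeval ξ P - (aeval ξ P - aeval α P)| := by ring_nf
      _ ≤ |aeval ξ P| + |aeval ξ P - aeval α P| := abs_sub _ _
      _ ≤ |aeval ξ P| + (n + 1) * (n * M ^ n) * P.supNorm * (K / h (i + 1)) := by
          gcongr
          exact hPd.trans (by gcongr)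
      _ = _ := by rw [hK2]; ring
  have hA0 : (0 : ℝ) ≤ (R i).leadingCoeff := by exact_mod_cast (H.lead_pos i).le
  have hA : ((R i).leadingCoeff : ℝ) ≤ K * h i :=
    (leadingCoeff_le_supNorm _).trans (H.supNorm_le i)
  rw [abs_mul, abs_mul, abs_pow, abs_of_nonneg hA0] at hres
  calc (1 : ℝ) ≤ _ := hres
    _ ≤ (K * h i) ^ n * ((|aeval ξ P| + K₂ * P.supNorm / h (i + 1)) *
        ((n + 1) * M ^ n * P.supNorm)) := by gcongr
    _ = K₁ * h i ^ n * P.supNorm * (|aeval ξ P| + K₂ * P.supNorm / h (i + 1)) := by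
        rw [hK1]; ring
    _ ≤ _ := by
        gcongr <;> linarith

/-- At `v = w` the inequality `1 + 2 * (n * v / (v - n)) ≤ w - 1` is hypothesis `hw` after clearing
denominators; continuity leaves room for some `v < w`. -/
lemma exists_exponent {n : ℕ} {s : ℝ} (hnw : n < w) (hw : 0 ≤ w ^ 2 - (3 * n + 2) * w + 2 * n)
    (hs : w - 1 < s) :
    ∃ v : ℝ, n < v ∧ v < w ∧ 1 + 2 * (n * v / (v - n)) < s := by
  have hpos : 0 < w - n := by linarith
  have hcont : ContinuousAt (fun v : ℝ => 1 + 2 * (n * v / (v - n))) w := by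
    have : w - n ≠ 0 := hpos.ne'
    fun_prop (disch := assumption)
  have hle : 1 + 2 * (n * w / (w - n)) ≤ w - 1 := by
    have : n * w / (w - n) ≤ (w - 2) / 2 := by
      rw [div_le_iff₀ hpos]; nlinarith
    linarith
  have h1 : ∀ᶠ v in 𝓝[<] w, 1 + 2 * (n * v / (v - n)) < s :=
    (hcont.eventually_lt continuousAt_const (hle.trans_lt hs)).filter_mono nhdsWithin_le_nhds
  have h2 : ∀ᶠ v in 𝓝[<] w, (n : ℝ) < v :=
    (eventually_gt_nhds hnw).filter_mono nhdsWithin_le_nhds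
  obtain ⟨v, ⟨hv1, hv2⟩, hv3⟩ := ((h1.and h2).and self_mem_nhdsWithin).exists
  exact ⟨v, hv2, hv3, hv1⟩

/-- The two bounds on `h` force `g ^ (v - n) ≤ T`; this eliminates `g` from `h ≤ T * g ^ n`. -/
lemma pow_le_rpow_of_step {g h T v : ℝ} {n : ℕ} (hg : 1 ≤ g) (hh : 1 ≤ h) (hv : n < v)
    (h1 : g ^ v ≤ h) (h2 : h ≤ T * g ^ n) : h ^ n ≤ T ^ (n * v / (v - n)) := by
  have hv0 : 0 < v - n := by linarith
  have hg0 : 0 < g := by linarith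
  have hgn : (0 : ℝ) < g ^ n := by positivity
  have h3 : g ^ (v - n) ≤ T := by
    rw [Real.rpow_sub hg0, Real.rpow_natCast, div_le_iff₀ hgn]
    exact h1.trans h2
  have hT : 0 < T := (Real.rpow_pos_of_pos hg0 _).trans_le h3
  have h4 : g ≤ T ^ (1 / (v - n)) := by
    calc g = (g ^ (v - n)) ^ (1 / (v - n)) := by
          rw [← Real.rpow_mul hg0.le, mul_one_div_cancel hv0.ne', Real.rpow_one]
      _ ≤ _ := Real.rpow_le_rpow (by positivity) h3 (by positivity)
  have h5 : h ≤ T ^ (v / (v - n)) := by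
    calc h ≤ T * g ^ n := h2
      _ ≤ T * (T ^ (1 / (v - n))) ^ n := by gcongr
      _ = T ^ (v / (v - n)) := by
          rw [← Real.rpow_natCast, ← Real.rpow_mul hT.le]
          nth_rw 1 [← Real.rpow_one T]
          rw [← Real.rpow_add hT]
          congr 1
          field_simp
          ring
  calc h ^ n ≤ (T ^ (v / (v - n))) ^ n := by gcongr
    _ = _ := by
        rw [← Real.rpow_natCast, ← Real.rpow_mul hT.le]
        congr 1
        ring

lemma exists_le_of_forall_not_dvd (H : IsQuadApprox ξ w D K R h) {n : ℕ} {s : ℝ} (hnw : n < w)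
    (hw2 : 2 ≤ w) (hw : 0 ≤ w ^ 2 - (3 * n + 2) * w + 2 * n) (hs : w - 1 < s) :
    ∃ c > 0, ∀ P : ℤ[X], P.natDegree ≤ n → (∀ i, ¬ R i ∣ P) →
      c ≤ |aeval ξ P| * P.supNorm ^ s := by
  obtain ⟨v, hnv, hvw, hvs⟩ := exists_exponent hnw hw hs
  obtain ⟨K', hK', hmul⟩ := H.exists_one_le_mul n
  obtain ⟨i₀, hi₀⟩ := eventually_atTop.1 (H.le_growth v hvw)
  have hK0 : 0 < K' := by linarith
  set e : ℝ := n * v / (v - n) with he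
  -- The first entry serves when the chosen index is `i₀` itself, the second when a preceding index
  -- is available.
  set C₀ : ℝ := max (h i₀ ^ n) ((2 * K' ^ 2) ^ e) with hC₀
  have hh₀ := H.one_le_h i₀
  have hC : 0 < C₀ := lt_max_of_lt_left (by positivity)
  refine ⟨1 / (2 * K' * C₀), by positivity, fun P hP hdvd => ?_⟩
  have hP0 : P ≠ 0 := fun h0 => hdvd 0 (h0 ▸ dvd_zero _)
  have hH := one_le_supNorm hP0
  set N := P.supNorm with hN
  have hN0 : 0 < N := by linarith
  -- With this `T`, the condition `T * h i ^ n ≤ h (i + 1)` makes the term containing `1 / h (i +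
  -- 1)` at most `1 / 2`.
  set T : ℝ := 2 * K' ^ 2 * N ^ 2 with hT
  have key : ∀ i, T * h i ^ n ≤ h (i + 1) → h i ^ n * N ≤ C₀ * N ^ s →
      1 / (2 * K' * C₀) ≤ |aeval ξ P| * N ^ s := by
    intro i h1 h2
    have h3 := hmul P hP i (hdvd i)
    have hp := H.one_le_h (i + 1)
    have hp0 : 0 < h (i + 1) := by linarith
    have h4 : K' * h i ^ n * N * (K' * N / h (i + 1)) ≤ 1 / 2 := by
      rw [mul_div_assoc', div_le_iff₀ hp0]
      rw [hT] at h1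
      linarith
    rw [← hN, mul_add] at h3
    have h5 : 1 ≤ 2 * K' * (h i ^ n * N) * |aeval ξ P| := by linarith
    rw [div_le_iff₀ (by positivity)]
    calc (1 : ℝ) ≤ 2 * K' * (h i ^ n * N) * |aeval ξ P| := h5
      _ ≤ 2 * K' * (C₀ * N ^ s) * |aeval ξ P| := by gcongr
      _ = _ := by ring
  -- Such an index exists because `h (i + 1) ≥ h i ^ v` with `v > n` and `h i → ∞`.
  have hex : ∃ j, T * h (i₀ + j) ^ n ≤ h (i₀ + j + 1) := by
    have hlim := (tendsto_rpow_atTop (sub_pos.2 hnv)).comp H.tendsto_h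
    obtain ⟨i, hi1, hi2⟩ := ((hlim.eventually_ge_atTop T).and (eventually_ge_atTop i₀)).exists
    obtain ⟨j, rfl⟩ := Nat.exists_eq_add_of_le hi2
    refine ⟨j, le_trans ?_ (hi₀ _ hi2)⟩
    have hp : 0 < h (i₀ + j) := by linarith [H.one_le_h (i₀ + j)]
    simp only [Function.comp_apply, Real.rpow_sub hp, Real.rpow_natCast] at hi1
    rwa [le_div_iff₀ (by positivity)] at hi1
  classical
  obtain ⟨j, hj, hmin⟩ : ∃ j, T * h (i₀ + j) ^ n ≤ h (i₀ + j + 1) ∧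
      ∀ k < j, ¬ T * h (i₀ + k) ^ n ≤ h (i₀ + k + 1) :=
    ⟨Nat.find hex, Nat.find_spec hex, fun k hk => Nat.find_min hex hk⟩
  -- For the first good index, failure at the preceding one bounds `h` by a power of `T`, hence by a
  -- power of the height of `P`.
  refine key _ hj ?_
  rcases j with _ | j
  · have h1 : N ≤ N ^ s := by
      simpa using Real.rpow_le_rpow_of_exponent_le hH (show (1 : ℝ) ≤ s by linarith)
    have h2 := le_max_left (h i₀ ^ n) ((2 * K' ^ 2) ^ e)
    exact mul_le_mul h2 h1 hN0.le hC.le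
  · have h1 := not_le.1 (hmin j (Nat.lt_succ_self j))
    have h2 := pow_le_rpow_of_step (H.one_le_h (i₀ + j)) (H.one_le_h (i₀ + j + 1)) hnv
      (hi₀ _ (Nat.le_add_right _ _)) h1.le
    have h3 : T ^ e = (2 * K' ^ 2) ^ e * N ^ (2 * e) := by
      rw [hT, Real.mul_rpow (by positivity) (by positivity), Real.rpow_mul hN0.le]
      norm_cast
    calc h (i₀ + (j + 1)) ^ n * N ≤ T ^ e * N := by gcongr; exact h2
      _ = (2 * K' ^ 2) ^ e * N ^ (1 + 2 * e) := by
          rw [h3, Real.rpow_add hN0, Real.rpow_one]; ring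
      _ ≤ C₀ * N ^ s := by
          refine mul_le_mul (le_max_right _ _) ?_ (by positivity) hC.le
          exact Real.rpow_le_rpow_of_exponent_le hH hvs.le

lemma exists_le_self (H : IsQuadApprox ξ w D K R h) {s : ℝ} (hs : w < s) (hs0 : 0 ≤ s) :
    ∃ c > 0, ∀ i, c ≤ |aeval ξ (R i)| * (R i).supNorm ^ s := by
  have hK : 0 < K := by linarith [H.one_le_K]
  have hnorm : ∀ i, 1 ≤ (R i).supNorm := fun i => one_le_supNorm (H.irreducible i).ne_zero
  refine exists_pos_forall_le_of_eventually_le (c := 1 / (K * K ^ s))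
    (fun i => mul_pos (H.abs_aeval_pos i) (Real.rpow_pos_of_pos (by linarith [hnorm i]) _))
    (by positivity) ?_
  filter_upwards [H.growth_le s hs] with i hi
  have h1 : h i ≤ K * (R i).supNorm :=
    (H.le_lead i).trans (by gcongr; exact leadingCoeff_le_supNorm _)
  have h2 := H.le_val i
  have := hnorm i
  have hh := H.one_le_h i
  rw [div_le_iff₀ (by positivity)]
  calc (1 : ℝ) ≤ K * |aeval ξ (R i)| * h (i + 1) := h2
    _ ≤ K * |aeval ξ (R i)| * (K * (R i).supNorm) ^ s := by
        gcongr
        exact hi.trans (Real.rpow_le_rpow (by linarith) h1 hs0)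
    _ = _ := by rw [Real.mul_rpow hK.le (by linarith)]; ring

/-- Induction on `m`: if `R i` divides `P`, the bounds for `R i` and for the cofactor multiply, and
Gelfond's inequality controls the product of the heights. The degree bound `n` stays fixed, so the
resultant estimate applies throughout. -/
lemma exists_le (H : IsQuadApprox ξ w D K R h) {n : ℕ} {s : ℝ} (hnw : n < w)
    (hw2 : 2 ≤ w) (hw : 0 ≤ w ^ 2 - (3 * n + 2) * w + 2 * n) (hs : w < s) {m : ℕ} (hm : m ≤ n) :
    ∃ c > 0, ∀ P : ℤ[X], P ≠ 0 → P.natDegree ≤ m → c ≤ |aeval ξ P| * P.supNorm ^ s := by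
  have hs0 : 0 ≤ s := by linarith
  obtain ⟨c₁, hc₁, h₁⟩ := H.exists_le_of_forall_not_dvd hnw hw2 hw (by linarith : w - 1 < s)
  obtain ⟨c₂, hc₂, h₂⟩ := H.exists_le_self hs hs0
  induction m with
  | zero =>
    refine ⟨c₁, hc₁, fun P hP0 hP => h₁ P (hP.trans hm) fun i hi => ?_⟩
    have := natDegree_le_of_dvd hi hP0
    rw [H.natDegree_eq] at this
    omega
  | succ m ih =>
    obtain ⟨c₃, hc₃, h₃⟩ := ih (by omega)
    set κ : ℝ := 2 ^ n * √(n + 1) with hκ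
    have hκ0 : 0 < κ := by positivity
    refine ⟨min c₁ (c₂ * c₃ / κ ^ s), by positivity, fun P hP0 hP => ?_⟩
    by_cases hd : ∀ i, ¬ R i ∣ P
    · exact (min_le_left _ _).trans (h₁ P (hP.trans hm) hd)
    push Not at hd
    obtain ⟨i, S, rfl⟩ := hd
    obtain ⟨hR0, hS0⟩ := mul_ne_zero_iff.1 hP0
    refine (min_le_right _ _).trans ?_
    have hdeg : S.natDegree ≤ m := by
      rw [natDegree_mul hR0 hS0, H.natDegree_eq] at hP
      omega
    have e₂ := h₂ i
    have e₃ := h₃ S hS0 hdeg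
    have hgel := supNorm_mul_supNorm_le hR0 hS0 (hP.trans hm)
    have := (R i).supNorm_nonneg
    have := S.supNorm_nonneg
    have := (R i * S).supNorm_nonneg
    rw [div_le_iff₀ (by positivity), map_mul, abs_mul]
    calc c₂ * c₃ ≤ (|aeval ξ (R i)| * (R i).supNorm ^ s) * (|aeval ξ S| * S.supNorm ^ s) := by
          gcongr
      _ = |aeval ξ (R i)| * |aeval ξ S| * ((R i).supNorm * S.supNorm) ^ s := by
          rw [Real.mul_rpow (by positivity) (by positivity)]; ring
      _ ≤ |aeval ξ (R i)| * |aeval ξ S| * (κ * (R i * S).supNorm) ^ s := by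
          gcongr
      _ = _ := by rw [Real.mul_rpow (by positivity) (by positivity)]; ring

lemma eq_of_dvd (H : IsQuadApprox ξ w D K R h) {P : ℤ[X]} (hP : Irreducible P)
    (hlead : 0 < P.leadingCoeff) {i : ℕ} (hd : R i ∣ P) : P = R i := by
  obtain ⟨u, hu⟩ := (H.irreducible i).dvd_symm hP hd |> fun h' => associated_of_dvd_dvd hd h'
  obtain ⟨r, hr, hru⟩ := Polynomial.isUnit_iff.1 u.isUnit
  rw [← hru] at hu
  rcases Int.isUnit_iff.1 hr with rfl | rfl
  · simpa using hu.symm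
  · have h1 := H.lead_pos i
    rw [← hu] at hlead
    simp at hlead
    omega

lemma norm_aeval_complex (P : ℤ[X]) (x : ℝ) : ‖aeval (x : ℂ) P‖ = |aeval x P| := by
  have : aeval (x : ℂ) P = ((aeval x P : ℝ) : ℂ) := aeval_algebraMap_apply ℂ x P
  rw [this, Complex.norm_real, Real.norm_eq_abs]

/-- With `A` the leading coefficient, `B` the coefficient of `X` and `z = 2 * A * α + B`, one has `z
^ 2 = D` and `R(ξ) = (ξ - α) * (A * (ξ - α) + z)`. -/
lemma norm_sub_mul_le (H : IsQuadApprox ξ w D K R h) {α : ℂ} {i : ℕ} (hα : aeval α (R i) = 0)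
    (hsmall : (R i).leadingCoeff * ‖(ξ : ℂ) - α‖ ≤ 1) :
    |aeval ξ (R i)| ≤ ‖(ξ : ℂ) - α‖ * (1 + D) := by
  have hev : ∀ x : ℂ, aeval x (R i) =
      (R i).coeff 2 * x ^ 2 + (R i).coeff 1 * x + (R i).coeff 0 := by
    intro x
    rw [aeval_eq_sum_range_of_natDegree_le (H.natDegree_eq i).le, Finset.sum_range_succ,
      Finset.sum_range_succ, Finset.sum_range_one]
    ring
  have hlc : (R i).leadingCoeff = (R i).coeff 2 := by rw [leadingCoeff, H.natDegree_eq]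
  have hlead := H.lead_pos i
  have hdisc : (((R i).coeff 1 : ℂ)) ^ 2 - 4 * (R i).coeff 2 * (R i).coeff 0 = D := by
    exact_mod_cast H.disc i
  rw [hlc] at hsmall hlead
  rw [hev] at hα
  set z : ℂ := 2 * (R i).coeff 2 * α + (R i).coeff 1 with hz
  have hz2 : z ^ 2 = D := by
    rw [hz, ← hdisc]
    linear_combination 4 * ((R i).coeff 2 : ℂ) * hα
  have hD : (4 : ℝ) ≤ D := by exact_mod_cast H.four_le
  have hzn : ‖z‖ ≤ D := by
    have h1 : ‖z‖ ^ 2 = D := by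
      rw [← norm_pow, hz2, Complex.norm_intCast, abs_of_pos (by linarith)]
    nlinarith [norm_nonneg z]
  have hfac : aeval (ξ : ℂ) (R i) = ((ξ : ℂ) - α) * ((R i).coeff 2 * ((ξ : ℂ) - α) + z) := by
    rw [hev, hz]
    linear_combination hα
  rw [← norm_aeval_complex, hfac, norm_mul]
  gcongr
  refine (norm_add_le _ _).trans (add_le_add ?_ hzn)
  rw [norm_mul, Complex.norm_intCast, abs_of_pos (by exact_mod_cast hlead)]
  exact hsmall

lemma exists_le_norm_sub (H : IsQuadApprox ξ w D K R h) {n : ℕ} {s : ℝ} (hnw : n < w)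
    (hw2 : 2 ≤ w) (hw : 0 ≤ w ^ 2 - (3 * n + 2) * w + 2 * n) (hs : w < s) :
    ∃ c > 0, ∀ (α : ℂ) (P : ℤ[X]), IsIntMinpoly P α → P.natDegree ≤ n →
      c ≤ ‖(ξ : ℂ) - α‖ * P.supNorm ^ s := by
  have hs0 : 0 ≤ s := by linarith
  -- Exponent `s - 1`, since `|P(ξ)| ≪ H(P) * |ξ - α|` costs one power of the height. Hence the
  -- threshold `w - 1`, not `w`, for polynomials without a factor `R i`.
  obtain ⟨c₁, hc₁, h₁⟩ := H.exists_le_of_forall_not_dvd hnw hw2 hw (by linarith : w - 1 < s - 1)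
  obtain ⟨c₂, hc₂, h₂⟩ := H.exists_le_self hs hs0
  have hD : (4 : ℝ) ≤ D := by exact_mod_cast H.four_le
  set L : ℝ := (n + 1) * (n * 2 ^ n) + 1 with hL
  have hL0 : 0 < L := by positivity
  refine ⟨min 1 (min (c₁ / L) (c₂ / (1 + D))), by positivity, ?_⟩
  rintro α P ⟨hirr, -, hlead, hα⟩ hP
  have hN := one_le_supNorm hirr.ne_zero
  have hN0 : 0 < P.supNorm := by linarith
  have hNs : P.supNorm ≤ P.supNorm ^ s := by
    simpa using Real.rpow_le_rpow_of_exponent_le hN (show (1 : ℝ) ≤ s by linarith)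
  have hnn := norm_nonneg ((ξ : ℂ) - α)
  by_cases hd : ∀ i, ¬ R i ∣ P
  · rcases le_total 1 ‖(ξ : ℂ) - α‖ with hbig | hsmall
    · exact (min_le_left _ _).trans (by nlinarith)
    refine (min_le_right _ _).trans ((min_le_left _ _).trans ?_)
    have hξ : ‖(ξ : ℂ)‖ ≤ 1 := by rw [Complex.norm_real]; exact H.abs_xi_le
    have hα2 : ‖α‖ ≤ 2 := by
      calc ‖α‖ = ‖(ξ : ℂ) - ((ξ : ℂ) - α)‖ := by ring_nf
        _ ≤ ‖(ξ : ℂ)‖ + ‖(ξ : ℂ) - α‖ := norm_sub_le _ _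
        _ ≤ 2 := by linarith
    have hlip := norm_aeval_sub_aeval_le hP one_le_two (x := (ξ : ℂ)) (y := α) (by linarith) hα2
    rw [hα, sub_zero, norm_aeval_complex] at hlip
    have h3 := h₁ P hP hd
    rw [div_le_iff₀ hL0]
    calc c₁ ≤ |aeval ξ P| * P.supNorm ^ (s - 1) := h3
      _ ≤ (L * P.supNorm * ‖(ξ : ℂ) - α‖) * P.supNorm ^ (s - 1) := by
          gcongr
          refine hlip.trans ?_
          gcongr
          linarith
      _ = ‖(ξ : ℂ) - α‖ * (P.supNorm ^ (s - 1) * P.supNorm) * L := by ring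
      _ = _ := by rw [← Real.rpow_add_one hN0.ne', sub_add_cancel]
  · push Not at hd
    obtain ⟨i, hi⟩ := hd
    obtain rfl := H.eq_of_dvd hirr hlead hi
    have hA := leadingCoeff_le_supNorm (R i)
    rcases le_total 1 ((R i).leadingCoeff * ‖(ξ : ℂ) - α‖) with hbig | hsmall
    · refine (min_le_left _ _).trans (hbig.trans ?_)
      rw [mul_comm]
      gcongr
      exact hA.trans hNs
    refine (min_le_right _ _).trans ((min_le_right _ _).trans ?_)
    have h3 := H.norm_sub_mul_le hα hsmall
    rw [div_le_iff₀ (by linarith)]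
    calc c₂ ≤ |aeval ξ (R i)| * (R i).supNorm ^ s := h₂ i
      _ ≤ ‖(ξ : ℂ) - α‖ * (1 + D) * (R i).supNorm ^ s := by gcongr
      _ = _ := by ring

lemma le_of_le_rpow_neg {c N r : ℝ} (hc : 0 < c) (hN : 1 ≤ N) (hr : 0 < r)
    (h : c ≤ N ^ (-r)) : N ≤ c ^ (-r⁻¹) := by
  have hN0 : 0 < N := by linarith
  calc N = (N ^ (-r)) ^ (-r⁻¹) := by
        rw [← Real.rpow_mul hN0.le, neg_mul_neg, mul_inv_cancel₀ hr.ne', Real.rpow_one]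
    _ ≤ c ^ (-r⁻¹) := Real.rpow_le_rpow_of_nonpos hc h (by simpa using hr.le)

/-- An exponent `x > s > w` would bound the heights of all solutions `P`, leaving only finitely
many. -/
lemma mahlerExponent_le (H : IsQuadApprox ξ w D K R h) {n : ℕ} (hnw : n < w)
    (hw2 : 2 ≤ w) (hw : 0 ≤ w ^ 2 - (3 * n + 2) * w + 2 * n) :
    mahlerExponent n ξ ≤ (w : EReal) := by
  refine sSup_le ?_
  rintro _ ⟨x, hx, rfl⟩
  refine EReal.coe_le_coe_iff.2 (le_of_not_gt fun hlt => hx ?_)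
  obtain ⟨s, hs1, hs2⟩ := exists_between hlt
  obtain ⟨c, hc, hle⟩ := H.exists_le hnw hw2 hw hs1 le_rfl
  refine (finite_setOf_natDegree_le_supNorm_le n (c ^ (-(x - s)⁻¹))).subset ?_
  rintro P ⟨hP, hpos, hval⟩
  have hP0 : P ≠ 0 := by rintro rfl; simp at hpos
  have hN := one_le_supNorm hP0
  have hN0 : 0 < P.supNorm := by linarith
  refine ⟨hP, le_of_le_rpow_neg hc hN (by linarith) ((hle P hP0 hP).trans ?_)⟩
  calc |aeval ξ P| * P.supNorm ^ s ≤ P.supNorm ^ (-x) * P.supNorm ^ s := by gcongr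
    _ = _ := by rw [← Real.rpow_add hN0]; ring_nf

lemma koksmaExponent_le (H : IsQuadApprox ξ w D K R h) {n : ℕ} (hnw : n < w)
    (hw2 : 2 ≤ w) (hw : 0 ≤ w ^ 2 - (3 * n + 2) * w + 2 * n) :
    koksmaExponent n ξ ≤ ((w - 1 : ℝ) : EReal) := by
  refine sSup_le ?_
  rintro _ ⟨x, hx, rfl⟩
  refine EReal.coe_le_coe_iff.2 (le_of_not_gt fun hlt => hx ?_)
  obtain ⟨s, hs1, hs2⟩ := exists_between (show w < x + 1 by linarith)
  obtain ⟨c, hc, hle⟩ := H.exists_le_norm_sub hnw hw2 hw hs1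
  refine ((finite_setOf_natDegree_le_supNorm_le n (c ^ (-(x + 1 - s)⁻¹))).biUnion
    fun P _ => P.rootSet_finite ℂ).subset ?_
  rintro α ⟨P, hmin, hP, hpos, hval⟩
  have hP0 : P ≠ 0 := hmin.1.ne_zero
  have hN := one_le_supNorm hP0
  have hN0 : 0 < P.supNorm := by linarith
  refine Set.mem_iUnion₂.2 ⟨P, ⟨hP, le_of_le_rpow_neg hc hN (by linarith)
    ((hle α P hmin hP).trans ?_)⟩, (mem_rootSet_of_ne hP0).2 hmin.2.2.2⟩
  calc ‖(ξ : ℂ) - α‖ * P.supNorm ^ s ≤ P.supNorm ^ (-x - 1) * P.supNorm ^ s := by gcongr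
    _ = _ := by rw [← Real.rpow_add hN0]; ring_nf

/-- The constants are absorbed by `h i ^ (v - x)` for some `v` strictly between `x` and `w`. -/
lemma eventually_abs_aeval_le (H : IsQuadApprox ξ w D K R h) {x : ℝ} (hx0 : 0 < x) (hx : x < w) :
    ∀ᶠ i in atTop, |aeval ξ (R i)| ≤ (R i).supNorm ^ (-x) := by
  obtain ⟨v, hxv, hvw⟩ := exists_between hx
  have hlim := (tendsto_rpow_atTop (sub_pos.2 hxv)).comp H.tendsto_h
  have hK : 0 < K := by linarith [H.one_le_K]
  filter_upwards [hlim.eventually_ge_atTop (K * K ^ x), H.le_growth v hvw] with i h1 h2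
  have hh : 0 < h i := by linarith [H.one_le_h i]
  have hN : 0 < (R i).supNorm := by linarith [one_le_supNorm (H.irreducible i).ne_zero]
  simp only [Function.comp_apply, Real.rpow_sub hh] at h1
  rw [le_div_iff₀ (by positivity)] at h1
  rw [Real.rpow_neg hN.le, ← one_div, le_div_iff₀ (by positivity)]
  have h3 : 0 < h (i + 1) := by linarith [H.one_le_h (i + 1)]
  calc |aeval ξ (R i)| * (R i).supNorm ^ x ≤ K / h (i + 1) * (K * h i) ^ x := by
        gcongr
        · exact H.abs_aeval_le i
        · exact H.supNorm_le i
    _ = (K * K ^ x * h i ^ x) / h (i + 1) := by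
        rw [Real.mul_rpow hK.le hh.le]; ring
    _ ≤ 1 := by
        rw [div_le_one h3]; exact h1.trans h2

lemma le_mahlerExponent (H : IsQuadApprox ξ w D K R h) {n : ℕ} (hn : 2 ≤ n) (hw : 0 < w) :
    (w : EReal) ≤ mahlerExponent n ξ := by
  refine le_sSup_image_coe_of_forall_mem hw fun x hx0 hx => ?_
  refine infinite_of_eventually_mem_of_tendsto_zero (u := R) (F := fun P => |aeval ξ P|)
    H.abs_aeval_pos H.tendsto_abs_aeval ?_
  filter_upwards [H.eventually_abs_aeval_le hx0 hx] with i hi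
  exact ⟨(H.natDegree_eq i).trans_le hn, H.abs_aeval_pos i, hi⟩

lemma le_koksmaExponent (H : IsQuadApprox ξ w D K R h) {n : ℕ} (hn : 2 ≤ n) (hw : 0 < w) :
    ((w - 1 : ℝ) : EReal) ≤ koksmaExponent n ξ := by
  have hroot : ∀ i, ∃ α : ℝ, aeval α (R i) = 0 ∧ |ξ - α| ≤ |aeval ξ (R i)| := by
    intro i
    obtain ⟨α, β, hfac, hα, -⟩ := exists_real_roots_of_discrim (H.natDegree_eq i) (H.lead_pos i)
      H.four_le (H.disc i) ξ
    refine ⟨α, ?_, hα⟩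
    have : aeval α (R i) = ((R i).map (Int.castRingHom ℝ)).eval α := by rw [eval_map, aeval_def]; rfl
    rw [this, hfac]
    simp
  choose α hα hclose using hroot
  have hnorm : ∀ i, ‖(ξ : ℂ) - (α i : ℂ)‖ = |ξ - α i| := by
    intro i
    rw [← Complex.ofReal_sub, Complex.norm_real, Real.norm_eq_abs]
  have hpos : ∀ i, 0 < ‖(ξ : ℂ) - (α i : ℂ)‖ := by
    intro i
    rw [hnorm, abs_pos, sub_ne_zero]
    intro h0
    have := H.abs_aeval_pos i
    rw [h0, hα] at this
    simp at this
  refine le_sSup_image_coe_of_forall_mem (l := -1) (by linarith) fun x hx0 hx => ?_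
  refine infinite_of_eventually_mem_of_tendsto_zero (u := fun i => (α i : ℂ))
    (F := fun z => ‖(ξ : ℂ) - z‖) hpos ?_ ?_
  · simp only [hnorm]
    exact squeeze_zero (fun _ => abs_nonneg _) hclose H.tendsto_abs_aeval
  · filter_upwards [H.eventually_abs_aeval_le (show 0 < x + 1 by linarith) (by linarith)] with i hi
    refine ⟨R i, ⟨H.irreducible i, (H.irreducible i).isPrimitive (by rw [H.natDegree_eq]; simp),
      H.lead_pos i, ?_⟩, (H.natDegree_eq i).trans_le hn, hpos i, ?_⟩
    · rw [← norm_eq_zero, norm_aeval_complex, hα, abs_zero]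
    · rw [hnorm, show -x - 1 = -(x + 1) by ring]
      exact (hclose i).trans hi

end IsQuadApprox

/-! ### Convergents of the continued fraction. -/

/-- Numerators of the convergents of `[0, c 1, c 2, …]`, starting from `p₋₁ = 1`, `p₀ = 0`. -/
def cfNum (c : ℕ → ℕ) : ℕ → ℕ
  | 0 => 1
  | 1 => 0
  | n + 2 => c (n + 1) * cfNum c (n + 1) + cfNum c n

/-- Denominators of the convergents of `[0, c 1, c 2, …]`, starting from `q₋₁ = 0`, `q₀ = 1`. -/
def cfDen (c : ℕ → ℕ) : ℕ → ℕ
  | 0 => 0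
  | 1 => 1
  | n + 2 => c (n + 1) * cfDen c (n + 1) + cfDen c n

section ContFrac

variable {c : ℕ → ℕ}

lemma cfNum_add_two (n : ℕ) : cfNum c (n + 2) = c (n + 1) * cfNum c (n + 1) + cfNum c n := rfl

lemma cfDen_add_two (n : ℕ) : cfDen c (n + 2) = c (n + 1) * cfDen c (n + 1) + cfDen c n := rfl

lemma contFracOfSeq_contsAux (n : ℕ) :
    (contFracOfSeq c).contsAux n = ⟨(cfNum c n : ℝ), (cfDen c n : ℝ)⟩ ∧
      (contFracOfSeq c).contsAux (n + 1) = ⟨(cfNum c (n + 1) : ℝ), (cfDen c (n + 1) : ℝ)⟩ := by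
  induction n with
  | zero =>
    constructor
    · simp [GenContFract.contsAux, cfNum, cfDen]
    · simp [GenContFract.contsAux, cfNum, cfDen, contFracOfSeq]
  | succ n ih =>
    refine ⟨ih.2, ?_⟩
    have hs : (contFracOfSeq c).s.get? n = some ⟨1, (c (n + 1) : ℝ)⟩ := rfl
    rw [GenContFract.contsAux_recurrence hs ih.1 ih.2, cfNum_add_two, cfDen_add_two]
    push_cast
    simp

lemma contFracOfSeq_convs (k : ℕ) :
    (contFracOfSeq c).convs k = (cfNum c (k + 1) : ℝ) / cfDen c (k + 1) := by
  rw [GenContFract.conv_eq_conts_a_div_conts_b, GenContFract.nth_cont_eq_succ_nth_contAux,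
    (contFracOfSeq_contsAux k).2]

lemma cfNum_mul_cfDen_sub (n : ℕ) :
    (cfNum c (n + 1) : ℤ) * cfDen c n - cfNum c n * cfDen c (n + 1) = (-1) ^ (n + 1) := by
  induction n with
  | zero => simp [cfNum, cfDen]
  | succ n ih =>
    rw [cfNum_add_two, cfDen_add_two, pow_succ, ← ih]
    push_cast
    ring

variable (hc : ∀ k, 0 < c k)
include hc

lemma cfDen_succ_pos (n : ℕ) : 0 < cfDen c (n + 1) := by
  induction n with
  | zero => simp [cfDen]
  | succ n ih => rw [cfDen_add_two]; have := Nat.mul_pos (hc (n + 1)) ih; omega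

lemma cfDen_le_succ (n : ℕ) : cfDen c n ≤ cfDen c (n + 1) := by
  rcases n with _ | n
  · simp [cfDen]
  · rw [cfDen_add_two]
    have := Nat.le_mul_of_pos_left (cfDen c (n + 1)) (hc (n + 1))
    omega

lemma le_cfDen_add_one (n : ℕ) : n ≤ cfDen c n + 1 := by
  induction n with
  | zero => simp
  | succ n ih =>
    rcases n with _ | _ | n
    · simp
    · have : 0 < cfDen c (0 + 1 + 1) := cfDen_succ_pos hc 1
      omega
    · rw [cfDen_add_two]
      have := Nat.le_mul_of_pos_left (cfDen c (n + 1 + 1)) (hc (n + 1 + 1))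
      have := cfDen_succ_pos hc n
      omega

lemma cfNum_le_cfDen (n : ℕ) : cfNum c (n + 1) ≤ cfDen c (n + 1) := by
  suffices h : cfNum c (n + 1) ≤ cfDen c (n + 1) ∧ cfNum c (n + 2) ≤ cfDen c (n + 2) from h.1
  induction n with
  | zero =>
    refine ⟨by simp [cfNum], ?_⟩
    have := hc 1
    simp only [cfNum, cfDen, zero_add, mul_zero, mul_one, add_zero]
    omega
  | succ n ih =>
    refine ⟨ih.2, ?_⟩
    rw [cfNum_add_two, cfDen_add_two]
    exact Nat.add_le_add (Nat.mul_le_mul_left _ ih.2) ih.1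

/-- The convergents converge to a limit `ξ` lying on alternating sides of them. -/
lemma exists_tendsto_convergents :
    ∃ ξ : ℝ, Tendsto (fun k => (cfNum c (k + 1) : ℝ) / cfDen c (k + 1)) atTop (𝓝 ξ) ∧
      ∀ j, 0 ≤ (-1 : ℝ) ^ (j + 1) * (cfDen c j * ξ - cfNum c j) := by
  have hpos : ∀ n, (0 : ℝ) < cfDen c (n + 1) := fun n => by exact_mod_cast cfDen_succ_pos hc n
  have hmono : ∀ n, (cfDen c n : ℝ) ≤ cfDen c (n + 1) := fun n => by
    exact_mod_cast cfDen_le_succ hc n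
  set t : ℕ → ℝ := fun j => 1 / ((cfDen c (j + 1) : ℝ) * cfDen c (j + 2)) with ht
  -- By the determinant identity the convergents are the partial sums of an alternating series with
  -- decreasing terms. This gives convergence and the side on which each convergent lies.
  have hsum : ∀ k, ∑ j ∈ Finset.range k, (-1 : ℝ) ^ j * t j =
      (cfNum c (k + 1) : ℝ) / cfDen c (k + 1) := by
    intro k
    induction k with
    | zero => simp [cfNum]
    | succ k ih =>
      rw [Finset.sum_range_succ, ih, ht]
      have hdet : (cfNum c (k + 2) : ℝ) * cfDen c (k + 1) - cfNum c (k + 1) * cfDen c (k + 2) =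
          (-1) ^ (k + 2) := by exact_mod_cast cfNum_mul_cfDen_sub (c := c) (k + 1)
      have h1 := (hpos k).ne'
      have h2 := (hpos (k + 1)).ne'
      field_simp
      rw [show (-1 : ℝ) ^ k = (-1) ^ (k + 2) by rw [pow_add]; norm_num, ← hdet]
      ring
  have hanti : Antitone t := by
    refine antitone_nat_of_succ_le fun n => ?_
    have h1 := hpos n
    have h2 := hpos (n + 1)
    have h3 := hmono (n + 1)
    have h4 := hmono (n + 2)
    simp only [ht]
    gcongr
  have hlim0 : Tendsto t atTop (𝓝 0) := by
    refine squeeze_zero (fun n => by have := hpos n; have := hpos (n + 1); positivity)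
      (fun n => ?_) tendsto_one_div_add_atTop_nhds_zero_nat
    have h1 : (1 : ℝ) ≤ cfDen c (n + 1) := by exact_mod_cast cfDen_succ_pos hc n
    have h2 : ((n + 2 : ℕ) : ℝ) ≤ cfDen c (n + 2) + 1 := by
      exact_mod_cast le_cfDen_add_one hc (n + 2)
    push_cast at h2
    refine one_div_le_one_div_of_le (by positivity) ?_
    nlinarith
  obtain ⟨ξ, hξ⟩ := hanti.tendsto_alternating_series_of_tendsto_zero hlim0
  refine ⟨ξ, by simpa only [hsum] using hξ, fun j => ?_⟩
  rcases j with _ | j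
  · simp [cfNum, cfDen]
  have hj := hpos j
  rcases Nat.even_or_odd' j with ⟨m, rfl | rfl⟩
  · have h1 := hanti.alternating_series_le_tendsto hξ m
    rw [hsum, div_le_iff₀ hj] at h1
    have : (-1 : ℝ) ^ (2 * m + 1 + 1) = 1 := Even.neg_one_pow ⟨m + 1, by ring⟩
    rw [this]
    linarith
  · have h1 := hanti.tendsto_le_alternating_series hξ m
    rw [hsum, le_div_iff₀ hj] at h1
    have : (-1 : ℝ) ^ (2 * m + 1 + 1 + 1) = -1 := Odd.neg_one_pow ⟨m + 1, by ring⟩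
    rw [this]
    linarith

end ContFrac

/-! ### Distances `|q_j ξ - p_j|`. -/

/-- The absolute value `|q_j ξ - p_j|`, when `ξ` is the value of `[0, c 1, c 2, …]`. -/
noncomputable def cfGap (c : ℕ → ℕ) (ξ : ℝ) (j : ℕ) : ℝ :=
  (-1 : ℝ) ^ (j + 1) * (cfDen c j * ξ - cfNum c j)

section Gap

variable {c : ℕ → ℕ} {ξ : ℝ}

/-- With nonnegative decreasing gaps, this puts the ratio of consecutive gaps between `c (j + 1)`
and `c (j + 1) + 1`. -/
lemma cfGap_recurrence (j : ℕ) :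
    cfGap c ξ j = c (j + 1) * cfGap c ξ (j + 1) + cfGap c ξ (j + 2) := by
  simp only [cfGap, cfNum_add_two, cfDen_add_two]
  push_cast
  ring

lemma cfDen_mul_cfGap_add (j : ℕ) :
    cfDen c (j + 1) * cfGap c ξ j + cfDen c j * cfGap c ξ (j + 1) = 1 := by
  have hdet : (cfNum c (j + 1) : ℝ) * cfDen c j - cfNum c j * cfDen c (j + 1) =
      (-1) ^ (j + 1) := by exact_mod_cast cfNum_mul_cfDen_sub (c := c) j
  have h1 : ((-1 : ℝ) ^ (j + 1)) * (-1) ^ (j + 1) = 1 := by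
    rw [← mul_pow]; norm_num
  simp only [cfGap, pow_succ (-1 : ℝ) (j + 1)]
  linear_combination (-1 : ℝ) ^ (j + 1) * hdet + h1

lemma cfDen_mul_cfGap_le (hξ : ∀ j, 0 ≤ cfGap c ξ j) (j : ℕ) :
    cfDen c (j + 1) * cfGap c ξ j ≤ 1 := by
  have h := cfDen_mul_cfGap_add (c := c) (ξ := ξ) j
  have := hξ (j + 1)
  have : (0 : ℝ) ≤ cfDen c j * cfGap c ξ (j + 1) := by positivity
  linarith

variable (hc : ∀ k, 0 < c k) (hξ : ∀ j, 0 ≤ cfGap c ξ j)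
include hc hξ

lemma cfGap_succ_le (j : ℕ) : cfGap c ξ (j + 1) ≤ cfGap c ξ j := by
  have h1 : (1 : ℝ) ≤ c (j + 1) := by exact_mod_cast hc (j + 1)
  have := hξ (j + 1)
  have := hξ (j + 2)
  rw [cfGap_recurrence j]
  nlinarith

lemma le_cfDen_mul_cfGap (j : ℕ) : 1 ≤ 2 * (cfDen c (j + 1) * cfGap c ξ j) := by
  have h := cfDen_mul_cfGap_add (c := c) (ξ := ξ) j
  have h1 : (cfDen c j : ℝ) ≤ cfDen c (j + 1) := by exact_mod_cast cfDen_le_succ hc j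
  have h2 : (cfDen c j : ℝ) * cfGap c ξ (j + 1) ≤ cfDen c (j + 1) * cfGap c ξ j :=
    mul_le_mul h1 (cfGap_succ_le hc hξ j) (hξ _) (by positivity)
  linarith

end Gap

/-- The positive root of `t ^ 2 - a * t - 1` lies strictly between `a` and `a + 1`, whereas `y / x`
lies in `[b, b + 1]` with `b ≠ a`. The form therefore stays comparable with `x ^ 2`. It is applied
both to gaps and to denominators. -/
lemma quadForm_bounds {a b : ℕ} (ha : 0 < a) (hab : a ≠ b) {x y : ℝ} (hx : 0 ≤ x)
    (h1 : b * x ≤ y) (h2 : y ≤ (b + 1) * x) :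
    x ^ 2 ≤ |y ^ 2 - a * (x * y) - x ^ 2| ∧
      |y ^ 2 - a * (x * y) - x ^ 2| ≤ ((b + 1) ^ 2 + a * (b + 1) + 1) * x ^ 2 := by
  have hy : 0 ≤ y := le_trans (by positivity) h1
  have ha' : (1 : ℝ) ≤ a := by exact_mod_cast ha
  constructor
  · rcases lt_or_gt_of_ne hab with h | h
    · have h3 : (a : ℝ) + 1 ≤ b := by exact_mod_cast h
      have h4 : (a + 1) * x ≤ y := le_trans (by gcongr) h1
      refine le_trans ?_ (le_abs_self _)
      nlinarith [mul_nonneg hy (sub_nonneg.2 h4), mul_nonneg hx (sub_nonneg.2 h4),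
        mul_nonneg (sub_nonneg.2 ha') (sq_nonneg x)]
    · have h3 : (b : ℝ) + 1 ≤ a := by exact_mod_cast h
      have h4 : y ≤ a * x := h2.trans (by gcongr)
      refine le_trans ?_ (neg_le_abs _)
      nlinarith [mul_nonneg hy (sub_nonneg.2 h4)]
  · have h3 : y ^ 2 ≤ ((b + 1) * x) ^ 2 := by gcongr
    have h4 : a * (x * y) ≤ a * (x * ((b + 1) * x)) := by gcongr
    have h5 : 0 ≤ a * (x * y) := by positivity
    rw [abs_le]
    constructor <;> nlinarith [sq_nonneg x, sq_nonneg y, mul_nonneg (Nat.cast_nonneg (α := ℝ) a) (Nat.cast_nonneg (α := ℝ) b), sq_nonneg ((b + 1) * x)]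

/-! ### The quadratic approximations. -/

/-- The integer polynomial `A X² + B X + E`. -/
noncomputable def intQuad (A B E : ℤ) : ℤ[X] := C A * X ^ 2 + C B * X + C E

lemma neg_intQuad (A B E : ℤ) : -intQuad A B E = intQuad (-A) (-B) (-E) := by
  simp only [intQuad, C_neg]
  ring

lemma aeval_intQuad (A B E : ℤ) (x : ℝ) : aeval x (intQuad A B E) = A * x ^ 2 + B * x + E := by
  simp [intQuad]

lemma intQuad_coeff (A B E : ℤ) : (intQuad A B E).coeff 2 = A ∧ (intQuad A B E).coeff 1 = B ∧
    (intQuad A B E).coeff 0 = E := by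
  simp [intQuad, coeff_X, coeff_C, -eq_intCast]

/-- The quadratic polynomial
`(q_j X - p_j)² + a (q_j X - p_j) (q_{j+1} X - p_{j+1}) - (q_{j+1} X - p_{j+1})²`. It vanishes
at the continued fraction that starts like `c` and continues with `a, a, …`. -/
noncomputable def cfQuad (c : ℕ → ℕ) (a j : ℕ) : ℤ[X] :=
  intQuad ((cfDen c j : ℤ) ^ 2 + a * (cfDen c j * cfDen c (j + 1)) - (cfDen c (j + 1) : ℤ) ^ 2)
    (-2 * (cfDen c j * cfNum c j : ℤ) -
      a * (cfDen c j * cfNum c (j + 1) + cfNum c j * cfDen c (j + 1)) +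
      2 * (cfDen c (j + 1) * cfNum c (j + 1)))
    ((cfNum c j : ℤ) ^ 2 + a * (cfNum c j * cfNum c (j + 1)) - (cfNum c (j + 1) : ℤ) ^ 2)

section Quad

variable {c : ℕ → ℕ} {a : ℕ}

lemma cfQuad_coeff_two (j : ℕ) : (cfQuad c a j).coeff 2 =
    (cfDen c j : ℤ) ^ 2 + a * (cfDen c j * cfDen c (j + 1)) - (cfDen c (j + 1) : ℤ) ^ 2 :=
  (intQuad_coeff _ _ _).1

lemma cfQuad_coeff_one (j : ℕ) : (cfQuad c a j).coeff 1 = -2 * (cfDen c j * cfNum c j : ℤ) -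
    a * (cfDen c j * cfNum c (j + 1) + cfNum c j * cfDen c (j + 1)) +
    2 * (cfDen c (j + 1) * cfNum c (j + 1)) :=
  (intQuad_coeff _ _ _).2.1

lemma cfQuad_coeff_zero (j : ℕ) : (cfQuad c a j).coeff 0 =
    (cfNum c j : ℤ) ^ 2 + a * (cfNum c j * cfNum c (j + 1)) - (cfNum c (j + 1) : ℤ) ^ 2 :=
  (intQuad_coeff _ _ _).2.2

lemma cfQuad_natDegree_le (j : ℕ) : (cfQuad c a j).natDegree ≤ 2 := natDegree_quadratic_le

/-- A further partial quotient `a` leaves the quadratic number unchanged, so its polynomial can only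
change sign. -/
lemma cfQuad_succ {j : ℕ} (h : c (j + 1) = a) : cfQuad c a (j + 1) = -cfQuad c a j := by
  rw [cfQuad, cfQuad, neg_intQuad, cfNum_add_two, cfDen_add_two, h]
  congr 1 <;> push_cast <;> ring

lemma abs_aeval_cfQuad_add (x : ℝ) (k m : ℕ) (h : ∀ j, k < j → j ≤ k + m → c j = a) :
    |aeval x (cfQuad c a (k + m))| = |aeval x (cfQuad c a k)| := by
  induction m with
  | zero => rfl
  | succ m ih =>
    rw [← add_assoc, cfQuad_succ (h (k + m + 1) (by omega) le_rfl), map_neg, abs_neg,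
      ih fun j h1 h2 => h j h1 (by omega)]

lemma aeval_cfQuad (ξ : ℝ) (j : ℕ) : aeval ξ (cfQuad c a j) =
    cfGap c ξ j ^ 2 - a * (cfGap c ξ (j + 1) * cfGap c ξ j) - cfGap c ξ (j + 1) ^ 2 := by
  have h1 : ((-1 : ℝ) ^ j) ^ 2 = 1 := by rw [← pow_mul, mul_comm, pow_mul]; norm_num
  have e1 : cfGap c ξ j ^ 2 = (cfDen c j * ξ - cfNum c j) ^ 2 := by
    simp only [cfGap, pow_succ (-1 : ℝ) j]; linear_combination (cfDen c j * ξ - cfNum c j) ^ 2 * h1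
  have e2 : cfGap c ξ (j + 1) ^ 2 = (cfDen c (j + 1) * ξ - cfNum c (j + 1)) ^ 2 := by
    simp only [cfGap, pow_succ (-1 : ℝ)]
    linear_combination (cfDen c (j + 1) * ξ - cfNum c (j + 1)) ^ 2 * h1
  have e3 : cfGap c ξ (j + 1) * cfGap c ξ j =
      -((cfDen c (j + 1) * ξ - cfNum c (j + 1)) * (cfDen c j * ξ - cfNum c j)) := by
    simp only [cfGap, pow_succ (-1 : ℝ)]
    linear_combination
      -((cfDen c (j + 1) * ξ - cfNum c (j + 1)) * (cfDen c j * ξ - cfNum c j)) * h1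
  rw [e1, e2, e3, cfQuad, aeval_intQuad]
  push_cast
  ring

/-- The polynomial arises from the form `x ^ 2 + a x y - y ^ 2` by a substitution of determinant
`±1`, which preserves the discriminant. -/
lemma cfQuad_disc (j : ℕ) :
    (cfQuad c a j).coeff 1 ^ 2 - 4 * (cfQuad c a j).coeff 2 * (cfQuad c a j).coeff 0 =
      (a : ℤ) ^ 2 + 4 := by
  have hdet := cfNum_mul_cfDen_sub (c := c) j
  have h1 : ((-1 : ℤ) ^ (j + 1)) ^ 2 = 1 := by rw [← pow_mul, mul_comm, pow_mul]; norm_num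
  rw [← hdet] at h1
  rw [cfQuad_coeff_one, cfQuad_coeff_two, cfQuad_coeff_zero]
  linear_combination ((a : ℤ) ^ 2 + 4) * h1

/-- At the point (`cfNum c (j + 1)`, `cfDen c (j + 1)`) the second linear form vanishes and the
first is `±1`. So the homogenised polynomial takes the value `1` there. -/
lemma cfQuad_isPrimitive (j : ℕ) : (cfQuad c a j).IsPrimitive := by
  rw [isPrimitive_iff_isUnit_of_C_dvd]
  intro r hr
  rw [C_dvd_iff_dvd_coeff] at hr
  have hdet := cfNum_mul_cfDen_sub (c := c) j
  have h1 : ((-1 : ℤ) ^ (j + 1)) ^ 2 = 1 := by rw [← pow_mul, mul_comm, pow_mul]; norm_num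
  rw [← hdet] at h1
  have h2 : (cfQuad c a j).coeff 2 * (cfNum c (j + 1) : ℤ) ^ 2 +
      (cfQuad c a j).coeff 1 * (cfNum c (j + 1) * cfDen c (j + 1)) +
      (cfQuad c a j).coeff 0 * (cfDen c (j + 1) : ℤ) ^ 2 = 1 := by
    rw [cfQuad_coeff_one, cfQuad_coeff_two, cfQuad_coeff_zero]
    linear_combination h1
  rw [isUnit_iff_dvd_one, ← h2]
  exact dvd_add (dvd_add ((hr 2).mul_right _) ((hr 1).mul_right _)) ((hr 0).mul_right _)

lemma not_isSquare_sq_add_four (ha : 0 < a) : ¬ IsSquare (a ^ 2 + 4) := by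
  rintro ⟨r, hr⟩
  have h1 : a < r := by nlinarith
  have h2 : r < a + 2 := by nlinarith
  obtain rfl : r = a + 1 := by omega
  have : 2 * a = 3 := by nlinarith
  omega

/-- A rational root `x` would make `2 * S.coeff 2 * x + S.coeff 1` a rational square root of `D`. -/
lemma irreducible_of_discrim {S : ℤ[X]} (hprim : S.IsPrimitive) (hdeg : S.natDegree = 2)
    {D : ℕ} (hD : ¬ IsSquare D) (hdisc : S.coeff 1 ^ 2 - 4 * S.coeff 2 * S.coeff 0 = D) :
    Irreducible S := by
  rw [IsPrimitive.Int.irreducible_iff_irreducible_map_cast hprim]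
  have hdeg' : (S.map (Int.castRingHom ℚ)).natDegree = 2 := by
    rw [natDegree_map_eq_of_injective (Int.castRingHom ℚ).injective_int, hdeg]
  rw [irreducible_iff_roots_eq_zero_of_degree_le_three hdeg'.ge (by omega),
    Multiset.eq_zero_iff_forall_notMem]
  intro x hx
  have h0 := (mem_roots'.1 hx).2
  have h1 : aeval x S = 0 := by
    rw [aeval_def, ← eval_map]; exact h0
  rw [aeval_eq_sum_range_of_natDegree_le hdeg.le, Finset.sum_range_succ,
    Finset.sum_range_succ, Finset.sum_range_one] at h1
  have h2 : (S.coeff 1 : ℚ) ^ 2 - 4 * S.coeff 2 * S.coeff 0 = D := by exact_mod_cast hdisc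
  refine hD (Rat.isSquare_natCast_iff.1 ⟨2 * S.coeff 2 * x + S.coeff 1, ?_⟩)
  rw [← h2]
  linear_combination -4 * (S.coeff 2 : ℚ) * h1

variable {b : ℕ} (hc : ∀ k, 0 < c k)
include hc

lemma supNorm_cfQuad_le {k : ℕ} (hk : 1 ≤ k) :
    (cfQuad c a k).supNorm ≤ (2 * a + 4) * (cfDen c (k + 1) : ℝ) ^ 2 := by
  obtain ⟨i, hi⟩ := (cfQuad c a k).exists_eq_supNorm
  obtain ⟨k, rfl⟩ := Nat.exists_eq_add_of_le' hk
  have h1 : (cfDen c (k + 1) : ℤ) ≤ cfDen c (k + 2) := by exact_mod_cast cfDen_le_succ hc (k + 1)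
  have h2 : (cfNum c (k + 1) : ℤ) ≤ cfDen c (k + 2) :=
    le_trans (by exact_mod_cast cfNum_le_cfDen hc k) h1
  have h3 : (cfNum c (k + 2) : ℤ) ≤ cfDen c (k + 2) := by
    exact_mod_cast cfNum_le_cfDen hc (k + 1)
  have key : ∀ x y : ℤ, 0 ≤ x → 0 ≤ y → x ≤ cfDen c (k + 2) → y ≤ cfDen c (k + 2) →
      0 ≤ x * y ∧ x * y ≤ (cfDen c (k + 2) : ℤ) ^ 2 := by
    intro x y hx hy h4 h5
    exact ⟨mul_nonneg hx hy, by rw [sq]; exact mul_le_mul h4 h5 hy (by positivity)⟩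
  have hQ0 : (0 : ℤ) ≤ cfDen c (k + 1) := by positivity
  have hQ1 : (0 : ℤ) ≤ cfDen c (k + 2) := by positivity
  have hP0 : (0 : ℤ) ≤ cfNum c (k + 1) := by positivity
  have hP1 : (0 : ℤ) ≤ cfNum c (k + 2) := by positivity
  have ha0 : (0 : ℤ) ≤ a := by positivity
  suffices h : |(cfQuad c a (k + 1)).coeff i| ≤ (2 * a + 4) * (cfDen c (k + 2) : ℤ) ^ 2 by
    rw [hi, Int.norm_eq_abs]
    exact_mod_cast h
  rw [abs_le]
  rcases i with _ | _ | _ | i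
  · rw [cfQuad_coeff_zero]
    obtain ⟨u1, u2⟩ := key _ _ hP0 hP0 h2 h2
    obtain ⟨v1, v2⟩ := key _ _ hP0 hP1 h2 h3
    obtain ⟨t1, t2⟩ := key _ _ hP1 hP1 h3 h3
    have r1 := mul_nonneg ha0 v1
    have r2 := mul_le_mul_of_nonneg_left v2 ha0
    have r3 := mul_nonneg ha0 (sq_nonneg (cfDen c (k + 2) : ℤ))
    constructor <;> nlinarith
  · rw [cfQuad_coeff_one]
    obtain ⟨u1, u2⟩ := key _ _ hQ0 hP0 h1 h2
    obtain ⟨v1, v2⟩ := key _ _ hQ0 hP1 h1 h3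
    obtain ⟨w1, w2⟩ := key _ _ hP0 hQ1 h2 le_rfl
    obtain ⟨t1, t2⟩ := key _ _ hQ1 hP1 le_rfl h3
    have r1 := mul_nonneg ha0 v1
    have r2 := mul_le_mul_of_nonneg_left v2 ha0
    have r3 := mul_nonneg ha0 w1
    have r4 := mul_le_mul_of_nonneg_left w2 ha0
    constructor <;> nlinarith
  · rw [cfQuad_coeff_two]
    obtain ⟨u1, u2⟩ := key _ _ hQ0 hQ0 h1 h1
    obtain ⟨v1, v2⟩ := key _ _ hQ0 hQ1 h1 le_rfl
    have r1 := mul_nonneg ha0 v1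
    have r2 := mul_le_mul_of_nonneg_left v2 ha0
    have r3 := mul_nonneg ha0 (sq_nonneg (cfDen c (k + 2) : ℤ))
    constructor <;> nlinarith
  · rw [coeff_eq_zero_of_natDegree_lt ((cfQuad_natDegree_le _).trans_lt (by omega))]
    have := mul_nonneg ha0 (sq_nonneg (cfDen c (k + 2) : ℤ))
    constructor <;> nlinarith

/-- Since `c k = b`, the ratio of the denominators at `k + 1` and `k` lies in `[b, b + 1]`. There is
no cancellation in the leading coefficient. -/
lemma cfDen_sq_le_abs_coeff_two (ha : 0 < a) (hab : a ≠ b) {k : ℕ} (hk : 1 ≤ k) (hb : c k = b) :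
    (cfDen c (k + 1) : ℝ) ^ 2 ≤ (b + 1) ^ 2 * |((cfQuad c a k).coeff 2 : ℝ)| := by
  obtain ⟨k, rfl⟩ := Nat.exists_eq_add_of_le' hk
  have hle : (cfDen c k : ℝ) ≤ cfDen c (k + 1) := by exact_mod_cast cfDen_le_succ hc k
  have hrec : (cfDen c (k + 2) : ℝ) = b * cfDen c (k + 1) + cfDen c k := by
    rw [cfDen_add_two, hb]; push_cast; ring
  have h2 : (cfDen c (k + 2) : ℝ) ≤ (b + 1) * cfDen c (k + 1) := by rw [hrec]; linarith
  have h1 := (quadForm_bounds ha hab (x := cfDen c (k + 1)) (y := cfDen c (k + 2))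
    (by positivity) (by rw [hrec]; simp) h2).1
  have h3 : ((cfQuad c a (k + 1)).coeff 2 : ℝ) = -((cfDen c (k + 2) : ℝ) ^ 2 -
      a * (cfDen c (k + 1) * cfDen c (k + 2)) - (cfDen c (k + 1) : ℝ) ^ 2) := by
    rw [cfQuad_coeff_two]; push_cast; ring
  rw [h3, abs_neg]
  calc (cfDen c (k + 2) : ℝ) ^ 2 ≤ ((b + 1) * cfDen c (k + 1)) ^ 2 := by gcongr
    _ = (b + 1) ^ 2 * (cfDen c (k + 1) : ℝ) ^ 2 := by ring
    _ ≤ _ := by gcongr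

/-- The value at `ξ` keeps its modulus along the block of `a`'s. At the end of the block the next
quotient is `b ≠ a`, so it is comparable with the square of `cfGap c ξ l`, itself comparable with `1
/ cfDen c (l + 1)`. -/
lemma abs_aeval_cfQuad_bounds {ξ : ℝ} (hξ : ∀ j, 0 ≤ cfGap c ξ j) (ha : 0 < a) (hab : a ≠ b)
    {k l : ℕ} (hkl : k < l) (hl : c l = b) (h : ∀ j, k < j → j < l → c j = a) :
    |aeval ξ (cfQuad c a k)| * (cfDen c (l + 1) : ℝ) ^ 2 ≤ (b + 1) ^ 2 + a * (b + 1) + 1 ∧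
      1 ≤ 4 * |aeval ξ (cfQuad c a k)| * (cfDen c (l + 1) : ℝ) ^ 2 := by
  obtain ⟨m, rfl⟩ := Nat.exists_eq_add_of_lt hkl
  rw [← abs_aeval_cfQuad_add ξ k m fun j h1 h2 => h j h1 (by omega), aeval_cfQuad]
  have hrec := cfGap_recurrence (c := c) (ξ := ξ) (k + m)
  have hle := cfGap_succ_le hc hξ (k + m + 1)
  have hnn := hξ (k + m + 2)
  rw [hl] at hrec
  obtain ⟨h1, h2⟩ := quadForm_bounds ha hab (hξ (k + m + 1)) (y := cfGap c ξ (k + m))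
    (by rw [hrec]; linarith) (by rw [hrec]; linarith)
  have h3 := cfDen_mul_cfGap_le hξ (k + m + 1)
  have h4 := le_cfDen_mul_cfGap hc hξ (k + m + 1)
  have h5 : 0 ≤ cfDen c (k + m + 1 + 1) * cfGap c ξ (k + m + 1) := by linarith
  set Q : ℝ := (cfDen c (k + m + 1 + 1) : ℝ)
  set e := cfGap c ξ (k + m + 1)
  set F := |cfGap c ξ (k + m) ^ 2 - a * (e * cfGap c ξ (k + m)) - e ^ 2|
  constructor
  · calc F * Q ^ 2 ≤ (((b + 1) ^ 2 + a * (b + 1) + 1) * e ^ 2) * Q ^ 2 := by gcongr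
      _ = ((b + 1) ^ 2 + a * (b + 1) + 1) * (Q * e) ^ 2 := by ring
      _ ≤ ((b + 1) ^ 2 + a * (b + 1) + 1) * 1 := by
          gcongr
          exact pow_le_one₀ h5 h3
      _ = _ := mul_one _
  · calc (1 : ℝ) ≤ (2 * (Q * e)) ^ 2 := one_le_pow₀ h4
      _ = 4 * e ^ 2 * Q ^ 2 := by ring
      _ ≤ 4 * F * Q ^ 2 := by gcongr

end Quad

/-! ### Growth of the denominators. -/

section Growth

variable {c : ℕ → ℕ} {a b : ℕ} {r : ℝ}

/-- A combination of consecutive denominators that every partial quotient `a` multiplies by `r`,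
where `r ^ 2 = a * r + 1`. -/
noncomputable def cfSize (c : ℕ → ℕ) (r : ℝ) (j : ℕ) : ℝ := r * cfDen c (j + 1) + cfDen c j

lemma cfSize_succ_of_eq (hr : r ^ 2 = a * r + 1) {j : ℕ} (h : c (j + 1) = a) :
    cfSize c r (j + 1) = r * cfSize c r j := by
  simp only [cfSize, cfDen_add_two, h]
  push_cast
  linear_combination (-(cfDen c (j + 1) : ℝ)) * hr

lemma cfSize_add (hr : r ^ 2 = a * r + 1) (k m : ℕ) (h : ∀ j, k < j → j ≤ k + m → c j = a) :
    cfSize c r (k + m) = r ^ m * cfSize c r k := by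
  induction m with
  | zero => simp
  | succ m ih =>
    rw [← add_assoc, cfSize_succ_of_eq hr (h (k + m + 1) (by omega) le_rfl),
      ih fun j h1 h2 => h j h1 (by omega), pow_succ]
    ring

lemma cfSize_succ_bounds (hr1 : 1 < r) {j : ℕ} (hb : 0 < b)
    (h : c (j + 1) = b) :
    cfSize c r j ≤ cfSize c r (j + 1) ∧ cfSize c r (j + 1) ≤ (b + 1) * r * cfSize c r j := by
  have hb1 : (1 : ℝ) ≤ b := by exact_mod_cast hb
  have h0 : (0 : ℝ) ≤ cfDen c j := by positivity
  have h1 : (0 : ℝ) ≤ cfDen c (j + 1) := by positivity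
  have hs : cfSize c r (j + 1) = (r * b + 1) * cfDen c (j + 1) + r * cfDen c j := by
    simp only [cfSize, cfDen_add_two, h]
    push_cast
    ring
  rw [hs, cfSize]
  constructor
  · gcongr
    · nlinarith
    · exact le_mul_of_one_le_left h0 hr1.le
  · have e1 : (r * b + 1) * (cfDen c (j + 1) : ℝ) ≤ ((b + 1) * r * r) * cfDen c (j + 1) := by
      gcongr
      nlinarith [mul_nonneg (mul_nonneg (zero_le_one.trans hb1) (by linarith : 0 ≤ r))
        (by linarith : 0 ≤ r - 1)]
    have e2 : r * (cfDen c j : ℝ) ≤ ((b + 1) * r) * cfDen c j := by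
      gcongr
      nlinarith
    linarith

variable (hc : ∀ k, 0 < c k)
include hc

lemma cfSize_pos (hr1 : 1 < r) (j : ℕ) : 0 < cfSize c r j := by
  have : (0 : ℝ) < cfDen c (j + 1) := by exact_mod_cast cfDen_succ_pos hc j
  rw [cfSize]
  positivity

/-- Each quotient `a` contributes exactly `log r`; only the single `b` at place `l` produces an
error, and it is bounded. -/
lemma abs_log_cfSize_sub_le (hr1 : 1 < r) (hr : r ^ 2 = a * r + 1) (hb : 0 < b) {k l : ℕ}
    (hkl : k < l) (hl : c l = b) (h : ∀ j, k < j → j < l → c j = a) :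
    |(Real.log (cfSize c r l) - l * Real.log r) - (Real.log (cfSize c r k) - k * Real.log r)| ≤
      Real.log ((b + 1) * r) + Real.log r := by
  obtain ⟨m, rfl⟩ := Nat.exists_eq_add_of_lt hkl
  have hadd := cfSize_add hr k m fun j h1 h2 => h j h1 (by omega)
  obtain ⟨h1, h2⟩ := cfSize_succ_bounds hr1 hb hl
  have hk := cfSize_pos hc hr1 k
  have hl' := cfSize_pos hc hr1 (k + m + 1)
  rw [hadd] at h1 h2
  have hr0 : 0 < r := by linarith
  have hL := Real.log_pos hr1
  have hB : 0 ≤ Real.log ((b + 1) * r) := by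
    refine Real.log_nonneg ?_
    have : (0 : ℝ) ≤ b := by positivity
    nlinarith
  have g1 := Real.log_le_log (by positivity) h1
  have g2 := Real.log_le_log hl' h2
  rw [Real.log_mul (by positivity) hk.ne', Real.log_pow] at g1
  rw [Real.log_mul (by positivity) (by positivity), Real.log_mul (by positivity) hk.ne',
    Real.log_pow] at g2
  push_cast
  rw [abs_le]
  constructor <;> linarith

variable {k : ℕ → ℕ}

lemma exists_abs_log_cfDen_sub_le (hr1 : 1 < r) (hr : r ^ 2 = a * r + 1) (hb : 0 < b)
    (hk : StrictMono k) (hkb : ∀ i, c (k i) = b)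
    (hka : ∀ i j, k i < j → j < k (i + 1) → c j = a) :
    ∃ C₁ C₂ : ℝ, ∀ i, |Real.log ((cfDen c (k i + 1) : ℝ) ^ 2) - 2 * Real.log r * k i| ≤
      C₁ * i + C₂ := by
  set L := Real.log r
  set C := Real.log ((b + 1) * r) + L
  set g : ℕ → ℝ := fun i => Real.log (cfSize c r (k i)) - k i * L with hg
  have hstep : ∀ i, |g i| ≤ C * i + |g 0| := by
    intro i
    induction i with
    | zero => simp
    | succ i ih =>
      have h1 : |g (i + 1) - g i| ≤ C := abs_log_cfSize_sub_le hc hr1 hr hb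
        (hk (Nat.lt_succ_self i)) (hkb _) (hka i)
      have h2 : |g (i + 1)| ≤ |g (i + 1) - g i| + |g i| := by
        simpa using abs_add_le (g (i + 1) - g i) (g i)
      push_cast
      linarith
  refine ⟨2 * C, 2 * |g 0| + 2 * Real.log (r + 1), fun i => ?_⟩
  have hQ : (0 : ℝ) < cfDen c (k i + 1) := by exact_mod_cast cfDen_succ_pos hc (k i)
  have hle : (cfDen c (k i) : ℝ) ≤ cfDen c (k i + 1) := by exact_mod_cast cfDen_le_succ hc (k i)
  have h0 : (0 : ℝ) ≤ cfDen c (k i) := by positivity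
  have h1 : (cfDen c (k i + 1) : ℝ) ≤ cfSize c r (k i) := by rw [cfSize]; nlinarith
  have h2 : cfSize c r (k i) ≤ (r + 1) * cfDen c (k i + 1) := by rw [cfSize]; nlinarith
  have g1 := Real.log_le_log hQ h1
  have g2 := Real.log_le_log (hQ.trans_le h1) h2
  rw [Real.log_mul (by linarith) hQ.ne'] at g2
  have g3 := abs_le.1 (hstep i)
  have g4 : 0 ≤ Real.log (r + 1) := Real.log_nonneg (by linarith)
  rw [Real.log_pow, abs_le]
  simp only [hg] at g3
  push_cast
  constructor <;> linarith [g3.1, g3.2]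

/-- One bounded error per occurrence of `b` gives a total error `O(i)`, negligible against `w ^ i`.
-/
lemma tendsto_log_cfDen_div {w : ℝ} (hw : 1 < w) (hr1 : 1 < r) (hr : r ^ 2 = a * r + 1)
    (hb : 0 < b) (hk : StrictMono k) (hkb : ∀ i, c (k i) = b)
    (hka : ∀ i j, k i < j → j < k (i + 1) → c j = a) (hkw : ∀ i, k i = ⌊w ^ i⌋₊) :
    Tendsto (fun i => Real.log ((cfDen c (k i + 1) : ℝ) ^ 2) / w ^ i) atTop
      (𝓝 (2 * Real.log r)) := by
  obtain ⟨C₁, C₂, hC⟩ := exists_abs_log_cfDen_sub_le hc hr1 hr hb hk hkb hka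
  have hw0 : ∀ i : ℕ, 0 < w ^ i := fun i => by positivity
  have hlin : Tendsto (fun i : ℕ => (C₁ * i + C₂) / w ^ i) atTop (𝓝 0) := by
    have h1 := (tendsto_pow_const_div_const_pow_of_one_lt 1 hw).const_mul C₁
    have h2 := (tendsto_pow_const_div_const_pow_of_one_lt 0 hw).const_mul C₂
    have h3 := h1.add h2
    simp only [mul_zero, add_zero] at h3
    refine h3.congr fun i => ?_
    ring
  have herr : Tendsto (fun i => (Real.log ((cfDen c (k i + 1) : ℝ) ^ 2) -
      2 * Real.log r * k i) / w ^ i) atTop (𝓝 0) := by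
    refine squeeze_zero_norm (fun i => ?_) hlin
    rw [Real.norm_eq_abs, abs_div, abs_of_pos (hw0 i)]
    exact div_le_div_of_nonneg_right (hC i) (hw0 i).le
  have hfl : Tendsto (fun i => (k i : ℝ) / w ^ i) atTop (𝓝 1) := by
    have := (tendsto_nat_floor_div_atTop (R := ℝ)).comp (tendsto_pow_atTop_atTop_of_one_lt hw)
    refine this.congr fun i => ?_
    simp [hkw]
  have := herr.add (hfl.const_mul (2 * Real.log r))
  simp only [zero_add, mul_one] at this
  refine this.congr fun i => ?_
  have := (hw0 i).ne'
  field_simp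
  ring

end Growth

lemma eventually_rpow_le_of_tendsto_log_div {h : ℕ → ℝ} {w M : ℝ} (hw : 0 < w) (hM : 0 < M)
    (hh : ∀ i, 0 < h i)
    (hlim : Tendsto (fun i => Real.log (h i) / w ^ i) atTop (𝓝 M)) :
    (∀ v < w, ∀ᶠ i in atTop, h i ^ v ≤ h (i + 1)) ∧
      ∀ v > w, ∀ᶠ i in atTop, h (i + 1) ≤ h i ^ v := by
  have h1 : Tendsto (fun i => Real.log (h (i + 1)) / w ^ i) atTop (𝓝 (w * M)) := by
    refine ((hlim.comp (tendsto_add_atTop_nat 1)).const_mul w).congr fun i => ?_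
    have : w ^ i ≠ 0 := by positivity
    simp only [Function.comp_apply, pow_succ]
    field_simp
  have hv : ∀ v i, Real.log (h i ^ v) = v * Real.log (h i) := fun v i => Real.log_rpow (hh i) v
  constructor
  · intro v hvw
    filter_upwards [(hlim.const_mul v).eventually_lt h1 (mul_lt_mul_of_pos_right hvw hM)] with i hi
    rw [mul_div_assoc', div_lt_div_iff_of_pos_right (by positivity), ← hv] at hi
    exact ((Real.log_lt_log_iff (Real.rpow_pos_of_pos (hh i) v) (hh _)).1 hi).le
  · intro v hvw
    filter_upwards [h1.eventually_lt (hlim.const_mul v) (mul_lt_mul_of_pos_right hvw hM)] with i hi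
    rw [mul_div_assoc', div_lt_div_iff_of_pos_right (by positivity), ← hv] at hi
    exact ((Real.log_lt_log_iff (hh _) (Real.rpow_pos_of_pos (hh i) v)).1 hi).le

lemma exists_one_lt_sq_eq {a : ℕ} (ha : 0 < a) : ∃ r : ℝ, 1 < r ∧ r ^ 2 = a * r + 1 := by
  have ha1 : (1 : ℝ) ≤ a := by exact_mod_cast ha
  have hs := Real.sq_sqrt (show (0 : ℝ) ≤ (a : ℝ) ^ 2 + 4 by positivity)
  have hs1 : 1 < √((a : ℝ) ^ 2 + 4) := Real.lt_sqrt_of_sq_lt (by nlinarith)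
  exact ⟨(a + √((a : ℝ) ^ 2 + 4)) / 2, by linarith, by linear_combination hs / 4⟩

/-! ### Construction of the approximations and conclusion. -/

/-- A continued fraction with partial quotients `a`, except for `b ≠ a` at the places
`⌊w ^ i⌋`, has good quadratic approximations. -/
lemma exists_isQuadApprox {c k : ℕ → ℕ} {a b : ℕ} {ξ w : ℝ} (ha : 0 < a) (hb : 0 < b)
    (hab : a ≠ b) (hw : 1 < w) (hc : ∀ j, 0 < c j) (hξ : ∀ j, 0 ≤ cfGap c ξ j)
    (hk1 : ∀ i, 1 ≤ k i) (hk : StrictMono k) (hkb : ∀ i, c (k i) = b)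
    (hka : ∀ i j, k i < j → j < k (i + 1) → c j = a) (hkw : ∀ i, k i = ⌊w ^ i⌋₊) :
    ∃ K R h, IsQuadApprox ξ w ((a : ℤ) ^ 2 + 4) K R h := by
  obtain ⟨r, hr1, hr⟩ := exists_one_lt_sq_eq ha
  set S : ℕ → ℤ[X] := fun i => cfQuad c a (k i) with hS
  set h : ℕ → ℝ := fun i => (cfDen c (k i + 1) : ℝ) ^ 2 with hh
  have hh1 : ∀ i, 1 ≤ h i := fun i =>
    one_le_pow₀ (by exact_mod_cast cfDen_succ_pos hc (k i))
  have hcoef : ∀ i, h i ≤ (b + 1) ^ 2 * |((S i).coeff 2 : ℝ)| := fun i =>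
    cfDen_sq_le_abs_coeff_two hc ha hab (hk1 i) (hkb i)
  have hS2 : ∀ i, (S i).coeff 2 ≠ 0 := by
    intro i h0
    have := hcoef i
    rw [h0] at this
    norm_num at this
    linarith [hh1 i]
  have hdeg : ∀ i, (S i).natDegree = 2 := fun i =>
    le_antisymm (cfQuad_natDegree_le _) (le_natDegree_of_ne_zero (hS2 i))
  have hirr : ∀ i, Irreducible (S i) := fun i =>
    irreducible_of_discrim (cfQuad_isPrimitive _) (hdeg i) (not_isSquare_sq_add_four ha)
      (by rw [cfQuad_disc]; push_cast; rfl)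
  -- Minimal polynomials have positive leading coefficient, and `cfQuad` may have either sign.
  have hsign : ∀ i, ∃ R : ℤ[X], (R = S i ∨ R = -S i) ∧ 0 < R.leadingCoeff := by
    intro i
    rcases lt_or_gt_of_ne (leadingCoeff_ne_zero.2 (hirr i).ne_zero) with h0 | h0
    · exact ⟨-S i, .inr rfl, by rw [leadingCoeff_neg]; omega⟩
    · exact ⟨S i, .inl rfl, h0⟩
  choose R hR hlead using hsign
  have hRdeg : ∀ i, (R i).natDegree = 2 := by
    intro i
    rcases hR i with e | e <;> simp [e, hdeg]
  have habs : ∀ i, |aeval ξ (R i)| = |aeval ξ (S i)| := by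
    intro i
    rcases hR i with e | e <;> simp [e]
  have hnorm : ∀ i, (R i).supNorm = (S i).supNorm := by
    intro i
    rcases hR i with e | e
    · rw [e]
    · rw [e, supNorm_eq_iSup, supNorm_eq_iSup]; simp
  have hRlead : ∀ i, ((R i).leadingCoeff : ℝ) = |((S i).coeff 2 : ℝ)| := by
    intro i
    have h0 := hlead i
    rw [leadingCoeff, hRdeg] at h0 ⊢
    have h1 : (R i).coeff 2 = |(S i).coeff 2| := by
      rw [← abs_of_pos h0]
      rcases hR i with e | e <;> simp [e]
    rw [h1, Int.cast_abs]
  have hval : ∀ i, |aeval ξ (S i)| * h (i + 1) ≤ (b + 1) ^ 2 + a * (b + 1) + 1 ∧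
      1 ≤ 4 * |aeval ξ (S i)| * h (i + 1) := fun i =>
    abs_aeval_cfQuad_bounds hc hξ ha hab (hk (Nat.lt_succ_self i)) (hkb _) (hka i)
  have ha0 : (0 : ℝ) ≤ a := by positivity
  have hb0 : (0 : ℝ) ≤ b := by positivity
  have hab0 : (0 : ℝ) ≤ a * (b + 1) := by positivity
  set K : ℝ := (b + 1) ^ 2 + a * (b + 1) + 2 * a + 4 with hK
  have hgrowth := eventually_rpow_le_of_tendsto_log_div (by linarith)
    (mul_pos two_pos (Real.log_pos hr1)) (fun i => by linarith [hh1 i])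
    (tendsto_log_cfDen_div hc hw hr1 hr hb hk hkb hka hkw)
  have hξ1 : cfGap c ξ 1 = ξ := by simp [cfGap, cfDen, cfNum]
  have hξ0 : cfGap c ξ 0 = 1 := by simp [cfGap, cfDen, cfNum]
  refine ⟨K, R, h, ?_⟩
  refine
    { nonneg := hξ1 ▸ hξ 1
      le_one := by simpa [hξ1, hξ0] using cfGap_succ_le hc hξ 0
      four_le := by nlinarith
      one_le_K := by nlinarith
      natDegree_eq := hRdeg
      irreducible := fun i => ?_
      lead_pos := hlead
      disc := fun i => ?_
      one_le_h := hh1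
      supNorm_le := fun i => ?_
      le_lead := fun i => ?_
      val_le := fun i => ?_
      le_val := fun i => ?_
      tendsto_h := ?_
      le_growth := hgrowth.1
      growth_le := hgrowth.2 }
  · rcases hR i with e | e
    · rw [e]; exact hirr i
    · rw [e]; exact (Associated.refl (S i)).neg_left.irreducible_iff.2 (hirr i)
  · rw [← cfQuad_disc (c := c) (a := a) (k i)]
    rcases hR i with e | e <;> simp [e, hS]
  · rw [hnorm]
    refine (supNorm_cfQuad_le hc (hk1 i)).trans ?_
    have : (0 : ℝ) ≤ h i := by linarith [hh1 i]
    refine mul_le_mul_of_nonneg_right ?_ this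
    nlinarith
  · rw [hRlead]
    refine (hcoef i).trans (mul_le_mul_of_nonneg_right ?_ (abs_nonneg _))
    linarith
  · rw [habs]
    linarith [(hval i).1]
  · rw [habs]
    refine (hval i).2.trans ?_
    have : (0 : ℝ) ≤ h (i + 1) := by linarith [hh1 (i + 1)]
    gcongr
    nlinarith
  · refine tendsto_atTop_mono (fun i => ?_) tendsto_natCast_atTop_atTop
    have h1 : (i : ℝ) ≤ cfDen c (k i + 1) := by
      have h2 := le_cfDen_add_one hc (k i + 1)
      have h3 := hk.id_le i
      simp only [id] at h3
      exact_mod_cast (show i ≤ cfDen c (k i + 1) by omega)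
    have h4 : (1 : ℝ) ≤ cfDen c (k i + 1) := by exact_mod_cast cfDen_succ_pos hc (k i)
    simp only [hh]
    nlinarith

lemma sparseSeq_pos {a b : ℕ} (ha : 0 < a) (hb : 0 < b) (w : ℝ) (j : ℕ) :
    0 < sparseSeq w a b j := by
  unfold sparseSeq
  split_ifs <;> assumption

lemma strictMono_floor_pow {w : ℝ} (hw : 2 ≤ w) : StrictMono fun i : ℕ => ⌊w ^ i⌋₊ := by
  refine strictMono_nat_of_lt_succ fun i => ?_
  have h1 : 1 ≤ w ^ i := one_le_pow₀ (by linarith)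
  have h2 : w ^ i + 1 ≤ w ^ (i + 1) := by rw [pow_succ]; nlinarith
  have h3 := Nat.floor_mono h2
  rw [Nat.floor_add_one (by linarith)] at h3
  exact h3

theorem mainTheorem9 (d : ℕ) (hd : 2 ≤ d) (w : ℝ)
    (hw : (3 * (d : ℝ) + 2 + Real.sqrt (9 * (d : ℝ) ^ 2 + 4 * (d : ℝ) + 4)) / 2 ≤ w)
    (a b : ℕ) (ha : 0 < a) (hb : 0 < b) (hab : a ≠ b) :
    ∃ ξ : ℝ, IsContFracValue (sparseSeq w a b) ξ ∧
      ∀ n : ℕ, 2 ≤ n → n ≤ d →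
        koksmaExponent n ξ = ((w - 1 : ℝ) : EReal) ∧
        mahlerExponent n ξ = ((w : ℝ) : EReal) := by
  have hd' : (2 : ℝ) ≤ d := by exact_mod_cast hd
  have hs := Real.sq_sqrt (show (0 : ℝ) ≤ 9 * (d : ℝ) ^ 2 + 4 * d + 4 by positivity)
  have hs0 := Real.sqrt_nonneg (9 * (d : ℝ) ^ 2 + 4 * d + 4)
  set s := Real.sqrt (9 * (d : ℝ) ^ 2 + 4 * d + 4)
  have hwd : 3 * (d : ℝ) + 2 ≤ 2 * w := by linarith
  have hquad : 0 ≤ w ^ 2 - (3 * d + 2) * w + 2 * d := by nlinarith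
  set c := sparseSeq w a b with hcdef
  have hc : ∀ j, 0 < c j := sparseSeq_pos ha hb w
  have hk : StrictMono fun i : ℕ => ⌊w ^ i⌋₊ := strictMono_floor_pow (by linarith)
  obtain ⟨ξ, hlim, hξ⟩ := exists_tendsto_convergents hc
  refine ⟨ξ, ?_, fun n hn hnd => ?_⟩
  · unfold IsContFracValue
    simpa only [contFracOfSeq_convs] using hlim
  obtain ⟨K, R, h, H⟩ := exists_isQuadApprox (k := fun i => ⌊w ^ i⌋₊) ha hb hab
    (by linarith) hc hξ
    (fun i => Nat.one_le_floor_iff _ |>.2 (one_le_pow₀ (by linarith))) hk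
    (fun i => by rw [hcdef, sparseSeq, if_pos ⟨i, rfl⟩])
    (fun i j h1 h2 => by
      rw [hcdef, sparseSeq, if_neg]
      rintro ⟨m, rfl⟩
      have h3 := hk.lt_iff_lt.1 h1
      have h4 := hk.lt_iff_lt.1 h2
      omega)
    (fun i => rfl)
  have hnd' : (n : ℝ) ≤ d := by exact_mod_cast hnd
  have hnw : (n : ℝ) < w := by linarith
  -- Passing from `d` to `n` adds `(d - n) * (3 * w - 2) ≥ 0`.
  have hquad' : 0 ≤ w ^ 2 - (3 * n + 2) * w + 2 * n := by
    nlinarith [mul_nonneg (sub_nonneg.2 hnd') (show 0 ≤ 3 * w - 2 by linarith)]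
  exact ⟨le_antisymm (H.koksmaExponent_le hnw (by linarith) hquad')
      (H.le_koksmaExponent hn (by linarith)),
    le_antisymm (H.mahlerExponent_le hnw (by linarith) hquad')
      (H.le_mahlerExponent hn (by linarith))⟩
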